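/- **Setting.** Let $d,M\in\mathbb N$, $T>0$, let $A\subset\mathbb R^d$ be compact with convex hull $\mathrm{co}(A)$ (so $\mathrm{co}(A)=A$ if $A$ is convex). Let $b(t,x,a)\in\mathbb R^d$ and $\sigma(t,x)\in\mathbb R^{d\times d}$ be continuous for $t\in[0,T]$, $x\in\mathbb R^d$, $a\in \mathrm{co}(A)$ and satisfy, for some $K>0$, $|b(t,x_1,a_1)-b(t,x_2,a_2)|\le K(|x_1-x_2|+|a_1-a_2|)$, $|\sigma(t,x_1)-\sigma(t,x_2)|\le K|x_1-x_2|$ and $|b(t,x,a)|+|\sigma(t,x)|\le K(1+|x|+|a|)$. Let $b$ be differentiable in $a$ at every $a\in A$, let $\Psi=(\Psi_1,\dots,\Psi_M)$ have Lipschitz entries $\Psi_j:\mathbb R^d\to\mathbb R$, let $\bar\Lambda\in\mathbb R^{M\times M}$, and let $\mu_0^1,\dots,\mu_0^M$ be initial laws on $\mathbb R^d$. For $r,\delta>0$ let $\phi_r=\gamma_\delta*\mathbb I_r$, where $\mathbb I_r$ is the indicator function of the ball $B_r$ of radius $r$ about $0$ divided by its volume, $\gamma_\delta(x)=\delta^{-d}\gamma(x/\delta)$,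 and $\gamma$ is a smooth, even probability density with compact support. Put $G_{\phi_r}[m](t,x)=\big(\int\phi_r(x-y)m_j(t,y)\,dy\big)_{j=1}^M$. $\mathcal A_d$ is the set of measurable $a:[0,T]\times\mathbb R^d\to A$. A *state* for $a=(a^1,\dots,a^M)\in\mathcal A_d^M$ is a vector $m=(m_1,\dots,m_M)$ of measurable functions on $[0,T]\times\mathbb R^d$ such that each $m_j(t,\cdot)$ is a probability density with finite second moment, $t\mapsto m_j(t,\cdot)$ is continuous on $[0,T]$ for weak convergence together with convergence of second moments, $m_j(0,\cdot)$ is the density of $\mu_0^j$, and $m_j$ is a weak solution of $\partial_t m_j=\tfrac12\mathrm{tr}(\nabla^2(\sigma\sigma^Tm_j))-\nabla\cdot(b(t,x,a^j(t,x))m_j)$: for all $f\in C_b^2(\mathbb R^d)$ and $t\in[0,T]$, $$\int f\,m_j(t,x)\,dx-\int f\,m_j(0,x)\,dx=\int_0^t\!\!\int\Big(b(s,x,a^j(s,x))\cdot\nabla f+\tfrac12\mathrm{tr}(\sigma\sigma^T\nabla^2f)\Big)m_j(s,x)\,dx\,ds .$$ The problem (OC) is to minimize, over all $a\in\mathcal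 A_d^M$ and all states $m$ for $a$, $$J(a,m)=\int_{\mathbb R^d}\Big[\int_0^T f(t,x,a,m)\,dt+\Psi(x)\cdot m(T,x)\Big]dx,\qquad f(t,x,a,m)=\tfrac12\sum_{j}|a^j(t,x)|^2m_j(t,x)+G_{\phi_r}[m]^T\bar\Lambda\, m(t,x).$$ **Theorem.** Let $\hat a\in\mathcal A_d^M$ and let $\hat m$ be a state for $\hat a$. Let $$H(t,x,a,m,p)=f(t,x,a,m)+\sum_{j=1}^M b(t,x,a^j(t,x))\,m_j(t,x)\cdot\nabla p_j(t,x),$$ and let $p=(p_1,\dots,p_M)$ solve the adjoint equation $$\frac{\partial p_j}{\partial t}=-\Big(\tfrac12|\hat a^j|^2+\big(G_{\phi_r}[\hat m]^T(\bar\Lambda+\bar\Lambda^T)\big)_j+b(t,x,\hat a^j)\cdot\nabla p_j+\tfrac12\mathrm{tr}(\sigma\sigma^T\nabla^2p_j)\Big),\qquad p_j(T,\cdot)=\Psi_j ,$$ in the following sense: $p_j$ is continuous on $[0,T]\times\mathbb R^d$; on $[0,T)\times\mathbb R^d$ it is twice differentiable in $x$ with $\nabla p_j$, $\nabla^2p_j$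 continuous, $|\nabla p_j|\le C(1+|x|)$, and $\nabla^2p_j$ bounded on $[0,\tau]\times\mathbb R^d$ for every $\tau<T$; and for a.e. $x$ the equation, integrated in time over $[s,t]$, holds for all $s,t\in[0,T)$ (as it does for classical solutions with these bounds). Consider, for each $t\in[0,T)$, the map $$(a,m)\longmapsto\int_{\mathbb R^d}H(t,x,a,m,p)\,dx$$ on pairs of an $M$-vector of measurable $\mathrm{co}(A)$-valued functions $a^j$ on $\mathbb R^d$ and an $M$-vector of probability densities $m_j$ on $\mathbb R^d$ with finite second moments. Assume that one of the following holds: 1. for every $t\in[0,T)$ this map is convex in the pair $(a,m)$; or 2. for every $t\in[0,T)$ it is convex in $a$ for fixed $m$ and convex in $m$ for fixed $a$, and $\hat m_j>0$ a.e. on $[0,T]\times\mathbb R^d$ for every $j$. If for all $j\in\{1,\dots,M\}$ and all $w^j\in\mathcal A_d$ the function $D_{a^j}H(t,x,\hat a(t,x),\hat m(t,x),p)\cdot w^j(t,x)$ is integrable on $[0,T]\times\mathbb R^d$ and $$\int_{\mathbb R^d}\int_0^T D_{a^j}H(t,x,\hat a(t,x),\hat m(t,x),p)\cdot w^j(t,x)\,dt\,dx=0,$$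 then $\hat a$ (with state $\hat m$) solves (OC): $J(\hat a,\hat m)\le J(a,m)$ for all $a\in\mathcal A_d^M$ and all states $m$ for $a$. -/

import Mathlib

open MeasureTheory Set
open scoped ContDiff Matrix

noncomputable section

/-- `ℝ^d` with the Euclidean norm. -/
abbrev Pt (d : ℕ) : Type := EuclideanSpace ℝ (Fin d)

/-- The Hessian matrix of a function on `ℝ^d`. -/
def hessian {d : ℕ} (f : Pt d → ℝ) (x : Pt d) : Matrix (Fin d) (Fin d) ℝ :=
  Matrix.of fun i k =>
    iteratedFDeriv ℝ 2 f x ![EuclideanSpace.single i (1 : ℝ), EuclideanSpace.single k (1 : ℝ)]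

/-- The Frobenius norm of a matrix. -/
def frobNorm {d : ℕ} (B : Matrix (Fin d) (Fin d) ℝ) : ℝ :=
  Real.sqrt (∑ i, ∑ k, B i k ^ 2)

/-- `f ∈ C_b^2(ℝ^d)`: twice continuously differentiable, bounded with its first and second
derivatives. -/
def IsCb2 {d : ℕ} (f : Pt d → ℝ) : Prop :=
  ContDiff ℝ 2 f ∧
    ∃ C : ℝ, ∀ x, |f x| ≤ C ∧ ‖fderiv ℝ f x‖ ≤ C ∧ ‖iteratedFDeriv ℝ 2 f x‖ ≤ C

/-- `u` is the density of a probability measure on `ℝ^d` with finite second moment. -/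
structure IsDensity2 {d : ℕ} (u : Pt d → ℝ) : Prop where
  measurable : Measurable u
  nonneg : ∀ x, 0 ≤ u x
  integrable : Integrable u
  integral_eq_one : ∫ x, u x = 1
  secondMoment : Integrable fun x => ‖x‖ ^ 2 * u x

/-- The raw data of the control problem with `M` crowds moving in `ℝ^d`
(the assumptions on the data are in `CrowdModel.Standing`). -/
structure CrowdModel (d M : ℕ) where
  /-- time horizon -/
  T : ℝ
  /-- set of control values -/
  A : Set (Pt d)
  /-- drift `b(t,x,a)` -/
  b : ℝ → Pt d → Pt d → Pt d
  /-- diffusion coefficient `σ(t,x)` -/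
  σ : ℝ → Pt d → Matrix (Fin d) (Fin d) ℝ
  /-- final costs `Ψ_j` -/
  Ψ : Fin M → Pt d → ℝ
  /-- crowd aversion weights (the matrix written `Λ` with a bar) -/
  Λ : Matrix (Fin M) (Fin M) ℝ
  /-- initial distributions -/
  μ₀ : Fin M → Measure (Pt d)
  /-- mollifier profile -/
  γ : Pt d → ℝ
  /-- mollification parameter -/
  δ : ℝ
  /-- radius of the personal space -/
  r : ℝ

namespace CrowdModel

variable {d M : ℕ} (S : CrowdModel d M)

/-- Standing assumptions. The drift is considered for control values in the convex hull of `A`,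
which is `A` itself if `A` is convex. -/
structure Standing : Prop where
  T_pos : 0 < S.T
  compact_A : IsCompact S.A
  r_pos : 0 < S.r
  δ_pos : 0 < S.δ
  γ_smooth : ContDiff ℝ ∞ S.γ
  γ_compactSupport : HasCompactSupport S.γ
  γ_nonneg : ∀ x, 0 ≤ S.γ x
  γ_symm : ∀ x, S.γ (-x) = S.γ x
  γ_integral : ∫ x, S.γ x = 1
  b_continuous : ContinuousOn (fun q : ℝ × Pt d × Pt d => S.b q.1 q.2.1 q.2.2)
    (Icc 0 S.T ×ˢ (univ ×ˢ convexHull ℝ S.A))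
  σ_continuous : ContinuousOn (fun q : ℝ × Pt d => S.σ q.1 q.2) (Icc 0 S.T ×ˢ univ)
  lipschitz_growth : ∃ K : ℝ, 0 < K ∧ ∀ t ∈ Icc 0 S.T, ∀ x₁ x₂ : Pt d,
    ∀ a₁ ∈ convexHull ℝ S.A, ∀ a₂ ∈ convexHull ℝ S.A,
      ‖S.b t x₁ a₁ - S.b t x₂ a₂‖ ≤ K * (‖x₁ - x₂‖ + ‖a₁ - a₂‖) ∧
      frobNorm (S.σ t x₁ - S.σ t x₂) ≤ K * ‖x₁ - x₂‖ ∧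
      ‖S.b t x₁ a₁‖ + frobNorm (S.σ t x₁) ≤ K * (1 + ‖x₁‖ + ‖a₁‖)
  Ψ_lipschitz : ∃ K : ℝ, 0 < K ∧ ∀ j, ∀ x₁ x₂ : Pt d, |S.Ψ j x₁ - S.Ψ j x₂| ≤ K * ‖x₁ - x₂‖
  /-- `D_a b` exists at the control values. -/
  b_differentiable : ∀ t ∈ Icc 0 S.T, ∀ x, ∀ α ∈ S.A, DifferentiableAt ℝ (S.b t x) α

/-- The normalized indicator function of the ball of radius `r` about the origin. -/
def ballIndicator (x : Pt d) : ℝ :=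
  (Metric.ball (0 : Pt d) S.r).indicator
    (fun _ => (volume (Metric.ball (0 : Pt d) S.r)).toReal⁻¹) x

/-- The rescaled mollifier `γ_δ`. -/
def mollifier (x : Pt d) : ℝ := (S.δ ^ d)⁻¹ * S.γ (S.δ⁻¹ • x)

/-- The interaction kernel `φ_r`, the convolution of `γ_δ` and the normalized indicator. -/
def kernel (x : Pt d) : ℝ := ∫ y, S.mollifier (x - y) * S.ballIndicator y

/-- The `j`-th entry of `G_{φ_r}[m](x)`; here `m` is a vector of densities at a fixed time. -/
def G (m : Fin M → Pt d → ℝ) (x : Pt d) (j : Fin M) : ℝ := ∫ y, S.kernel (x - y) * m j y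

/-- The generator term `½ tr(σσᵀ(t,x) ∇²f(x))`. -/
def diffusionTerm (t : ℝ) (f : Pt d → ℝ) (x : Pt d) : ℝ :=
  (1 / 2) * (S.σ t x * (S.σ t x)ᵀ * hessian f x).trace

/-- The set `𝒜_d` of admissible deterministic controls: measurable and `A`-valued. Since `A` is
bounded, `∫∫ |a|² m dx dt < ∞` holds for every flow `m` of probability densities. -/
def IsControl (a : ℝ → Pt d → Pt d) : Prop :=
  Measurable (Function.uncurry a) ∧ ∀ t x, a t x ∈ S.A

/-- `m = (m_1,…,m_M)` is a state for the control vector `a`: for each `j`, `m_j` is a weak solution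
of `∂m_j/∂t = ½ tr(∇²(σσᵀ m_j)) - ∇·(b(t,x,a^j) m_j)` with `m_j(0,·)` the density of `μ₀ j`, given
by a curve of densities that is continuous on `[0,T]` for the topology of weak convergence of
probability measures and convergence of second moments. -/
structure IsState (a : Fin M → ℝ → Pt d → Pt d) (m : Fin M → ℝ → Pt d → ℝ) : Prop where
  measurable : ∀ j, Measurable (Function.uncurry (m j))
  density : ∀ j, ∀ t ∈ Icc 0 S.T, IsDensity2 (m j t)
  weak_continuous : ∀ j, ∀ g : BoundedContinuousFunction (Pt d) ℝ,
    ContinuousOn (fun t => ∫ x, g x * m j t x) (Icc 0 S.T)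
  moment_continuous : ∀ j, ContinuousOn (fun t => ∫ x, ‖x‖ ^ 2 * m j t x) (Icc 0 S.T)
  equation : ∀ j, ∀ f : Pt d → ℝ, IsCb2 f → ∀ t ∈ Icc 0 S.T,
    (∫ x, f x * m j t x) - (∫ x, f x * m j 0 x) =
      ∫ s in (0 : ℝ)..t, ∫ x,
        (inner ℝ (S.b s x (a j s x)) (gradient f x) + S.diffusionTerm s f x) * m j s x
  initial : ∀ j, S.μ₀ j = volume.withDensity fun x => ENNReal.ofReal (m j 0 x)

/-- The running cost `f = ½|a|²·m + G_{φ_r}[m]ᵀ Λ m` at a point `x`, where `α` is the vector of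
control values at `x` and `m` the vector of densities at the current time. -/
def runningCost (x : Pt d) (α : Fin M → Pt d) (m : Fin M → Pt d → ℝ) : ℝ :=
  (∑ j, (1 / 2) * ‖α j‖ ^ 2 * m j x) + S.G m x ⬝ᵥ (S.Λ *ᵥ fun j => m j x)

/-- The cost functional of the control problem. -/
def cost (a : Fin M → ℝ → Pt d → Pt d) (m : Fin M → ℝ → Pt d → ℝ) : ℝ :=
  ∫ x, ((∫ t in (0 : ℝ)..S.T, S.runningCost x (fun j => a j t x) (fun j => m j t)) +
    ∑ j, S.Ψ j x * m j S.T x)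

/-- The control vector `a`, with state `m`, solves the optimal control problem: it minimizes the
cost among all admissible control vectors and all states that belong to them. -/
def SolvesOC (a : Fin M → ℝ → Pt d → Pt d) (m : Fin M → ℝ → Pt d → ℝ) : Prop :=
  (∀ j, S.IsControl (a j)) ∧ S.IsState a m ∧
    ∀ a' m', (∀ j, S.IsControl (a' j)) → S.IsState a' m' → S.cost a m ≤ S.cost a' m'

/-- The Hamiltonian `H(t,x,a,m,p) = f + ∑_j b(t,x,a^j) m_j · ∇p_j`, as a function of the control
values `α` at `(t,x)` and the vector `m` of densities at time `t`. -/
def hamiltonian (t : ℝ) (x : Pt d) (α : Fin M → Pt d) (m : Fin M → Pt d → ℝ)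
    (p : Fin M → ℝ → Pt d → ℝ) : ℝ :=
  S.runningCost x α m + ∑ j, inner ℝ (m j x • S.b t x (α j)) (gradient (p j t) x)

/-- The partial derivative `D_{a^j} H(t,x,α,m,p) · w`. -/
def dHamiltonian (j : Fin M) (t : ℝ) (x : Pt d) (α : Fin M → Pt d) (m : Fin M → Pt d → ℝ)
    (p : Fin M → ℝ → Pt d → ℝ) (w : Pt d) : ℝ :=
  fderiv ℝ (fun v => S.hamiltonian t x (Function.update α j v) m p) (α j) w

/-- The bracket on the right-hand side of the adjoint equation for `p_j`, at `(t,x)`. -/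
def adjointBracket (a : Fin M → ℝ → Pt d → Pt d) (m p : Fin M → ℝ → Pt d → ℝ)
    (j : Fin M) (t : ℝ) (x : Pt d) : ℝ :=
  (1 / 2) * ‖a j t x‖ ^ 2 + (S.G (fun k => m k t) x ᵥ* (S.Λ + S.Λᵀ)) j +
    inner ℝ (S.b t x (a j t x)) (gradient (p j t) x) + S.diffusionTerm t (p j t) x

/-- `p` solves the backward adjoint equation `∂p_j/∂t = -(adjointBracket)`, `p_j(T,·) = Ψ_j`:
`p_j` is continuous on `[0,T] × ℝ^d`, twice differentiable in `x` on `[0,T) × ℝ^d` with continuous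
derivatives there, `∇p_j` grows at most linearly, `∇²p_j` is bounded away from the final time, and
the equation holds in integrated form in time (for a classical solution this is the fundamental
theorem of calculus; as the control is only measurable, `∂p_j/∂t` need not be continuous). -/
structure IsAdjoint (a : Fin M → ℝ → Pt d → Pt d) (m p : Fin M → ℝ → Pt d → ℝ) : Prop where
  continuous : ∀ j, ContinuousOn (Function.uncurry (p j)) (Icc 0 S.T ×ˢ univ)
  contDiff : ∀ j, ∀ t ∈ Ico 0 S.T, ContDiff ℝ 2 (p j t)
  gradient_continuous : ∀ j,
    ContinuousOn (fun q : ℝ × Pt d => gradient (p j q.1) q.2) (Ico 0 S.T ×ˢ univ)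
  hessian_continuous : ∀ j,
    ContinuousOn (fun q : ℝ × Pt d => iteratedFDeriv ℝ 2 (p j q.1) q.2) (Ico 0 S.T ×ˢ univ)
  gradient_growth : ∃ C : ℝ, ∀ j, ∀ t ∈ Ico 0 S.T, ∀ x, ‖gradient (p j t) x‖ ≤ C * (1 + ‖x‖)
  hessian_bound : ∀ τ ∈ Ico 0 S.T, ∃ C : ℝ, ∀ j, ∀ t ∈ Icc 0 τ, ∀ x,
    ‖iteratedFDeriv ℝ 2 (p j t) x‖ ≤ C
  equation : ∀ j, ∀ᵐ x, ∀ s ∈ Ico 0 S.T, ∀ t ∈ Ico 0 S.T,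
    p j t x - p j s x = -∫ u in s..t, S.adjointBracket a m p j u x
  terminal : ∀ j x, p j S.T x = S.Ψ j x

/-- Vectors of control profiles at a fixed time, with values in the convex hull of `A`. -/
def controlProfiles : Set (Fin M → Pt d → Pt d) :=
  {a | ∀ j, Measurable (a j) ∧ ∀ x, a j x ∈ convexHull ℝ S.A}

/-- Vectors of probability densities on `ℝ^d` with finite second moments. -/
def densityProfiles : Set (Fin M → Pt d → ℝ) := {m | ∀ j, IsDensity2 (m j)}

/-- `∫ H(t,x,a,m,p) dx` as a function of the profiles `a` and `m` at time `t`. -/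
def totalHamiltonian (p : Fin M → ℝ → Pt d → ℝ) (t : ℝ)
    (a : Fin M → Pt d → Pt d) (m : Fin M → Pt d → ℝ) : ℝ :=
  ∫ x, S.hamiltonian t x (fun j => a j x) m p

/-- `(a,m) ↦ ∫ H(t,x,a,m,p) dx` is convex in the pair `(a,m)`, for every `t` (at `t = T`, where
`∇p` need not exist, nothing is asked). -/
def HamiltonianConvex (p : Fin M → ℝ → Pt d → ℝ) : Prop :=
  ∀ t ∈ Ico 0 S.T,
    ConvexOn ℝ (S.controlProfiles ×ˢ densityProfiles) fun q => S.totalHamiltonian p t q.1 q.2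

/-- `(a,m) ↦ ∫ H(t,x,a,m,p) dx` is convex in `a` for fixed `m` and in `m` for fixed `a`, for
every `t`. -/
def HamiltonianSepConvex (p : Fin M → ℝ → Pt d → ℝ) : Prop :=
  ∀ t ∈ Ico 0 S.T,
    (∀ m ∈ densityProfiles, ConvexOn ℝ S.controlProfiles fun a => S.totalHamiltonian p t a m) ∧
    (∀ a ∈ S.controlProfiles, ConvexOn ℝ densityProfiles fun m => S.totalHamiltonian p t a m)

/-- The first variation of `H` in the controls vanishes: for all `j` and all `w ∈ 𝒜_d` the
integral `∫∫ D_{a^j}H(t,x,a,m,p) · w dt dx` exists and is zero. -/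
def FirstVariationVanishes (a : Fin M → ℝ → Pt d → Pt d) (m p : Fin M → ℝ → Pt d → ℝ) : Prop :=
  ∀ j, ∀ w, S.IsControl w →
    IntegrableOn (fun z : ℝ × Pt d => S.dHamiltonian j z.1 z.2 (fun k => a k z.1 z.2)
      (fun k => m k z.1) p (w z.1 z.2)) (Icc 0 S.T ×ˢ univ) ∧
    ∫ x, ∫ t in (0 : ℝ)..S.T, S.dHamiltonian j t x (fun k => a k t x)
      (fun k => m k t) p (w t x) = 0

end CrowdModel

end

/-!
Pairing the state equation of a competitor `(a', m')` with the adjoint state `p` cancels the second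
order terms, so that
`J(a', m') = ∑ j, ∫ p_j(0,·) dμ₀ʲ + ∫₀ᵀ R(t, a'(t), m'(t)) dt`,
where `R(t,·)` is the total Hamiltonian minus its linearization in the densities at the reference
pair `(a, m)`. It is therefore enough that `(a(t), m(t))` minimizes `R(t,·)` for almost every `t`.
There the one-sided derivative of `R(t,·)` in the densities vanishes by construction, and the one in
the controls by the first variation condition, localized by splicing controls; joint convexity then
gives minimality. If convexity is only separate, one compares `(a, m)` with `(a, m')` and then
`(a, m')` with `(a', m')`; as `m > 0`, the first variation condition also holds with `m'` in place
of `m`.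

The pairing is differentiated at almost every time by Lebesgue differentiation of the integrated
adjoint equation, for spatial truncations of `p` on `[0,τ]` with `τ < T`. The truncation is removed
by the second moments, and `τ → T` by their uniform integrability.
-/

section PairingCalculus

open Filter Function Topology
open scoped NNReal

theorem tendsto_slope_one_div_nat {Φ : ℝ → ℝ} {Φ' t : ℝ} (hΦ : HasDerivAt Φ Φ' t) :
    Tendsto (fun n : ℕ => ((n : ℝ) + 1) * (Φ (t + 1 / (n + 1)) - Φ t)) atTop (𝓝 Φ') := by
  have hstep : Tendsto (fun n : ℕ => 1 / ((n : ℝ) + 1)) atTop (𝓝[>] 0) :=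
    tendsto_nhdsWithin_iff.2 ⟨tendsto_one_div_add_atTop_nhds_zero_nat,
      Eventually.of_forall fun n => mem_Ioi.2 Nat.one_div_pos_of_nat⟩
  refine (hΦ.tendsto_slope_zero_right.comp hstep).congr fun n => ?_
  simp only [Function.comp_apply, one_div, inv_inv, smul_eq_mul]

theorem integral_eq_sub_of_lipschitzOnWith {K : ℝ≥0} {Φ φ : ℝ → ℝ} {a b : ℝ} (hab : a ≤ b)
    (hΦ : LipschitzOnWith K Φ (Icc a b))
    (hφ : ∀ᵐ t, t ∈ Ioo a b →
      Tendsto (fun n : ℕ => ((n : ℝ) + 1) * (Φ (t + 1 / (n + 1)) - Φ t)) atTop (𝓝 (φ t))) :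
    ∫ t in a..b, φ t = Φ b - Φ a := by
  have hac : AbsolutelyContinuousOnInterval Φ a b :=
    LipschitzOnWith.absolutelyContinuousOnInterval (by rwa [uIcc_of_le hab])
  rw [← hac.integral_deriv_eq_sub, intervalIntegral.integral_of_le hab,
    intervalIntegral.integral_of_le hab, integral_Ioc_eq_integral_Ioo, integral_Ioc_eq_integral_Ioo]
  refine setIntegral_congr_ae measurableSet_Ioo ?_
  filter_upwards [hac.ae_differentiableAt, hφ] with t hdiff hslope ht
  have hderiv := (hdiff (by rw [uIcc_of_le hab]; exact Ioo_subset_Icc_self ht)).hasDerivAt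
  exact tendsto_nhds_unique (hslope ht) (tendsto_slope_one_div_nat hderiv)

theorem measurable_intervalIntegral_translate {X : Type*} [MeasurableSpace X] {g : ℝ → X → ℝ}
    (hg : Measurable (uncurry g)) (h : ℝ) :
    Measurable fun z : ℝ × X => ∫ u in z.1..z.1 + h, g u z.2 := by
  have hshift (z : ℝ × X) : ∫ u in z.1..z.1 + h, g u z.2 = ∫ v in (0 : ℝ)..h, g (z.1 + v) z.2 := by
    rw [intervalIntegral.integral_comp_add_left (fun u => g u z.2), add_zero]
  have htranslate : Measurable fun y : (ℝ × X) × ℝ => (y.1.1 + y.2, y.1.2) := by fun_prop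
  have hmeas : StronglyMeasurable (uncurry fun (z : ℝ × X) v => g (z.1 + v) z.2) :=
    (hg.comp htranslate).stronglyMeasurable
  simp_rw [hshift, intervalIntegral]
  exact hmeas.integral_prod_right.measurable.sub hmeas.integral_prod_right.measurable

theorem ae_ae_tendsto_average {X : Type*} [MeasurableSpace X] {μ : Measure X} [SFinite μ]
    {g : ℝ → X → ℝ} (hg : AEStronglyMeasurable (uncurry g) (volume.prod μ))
    (hloc : ∀ᵐ x ∂μ, LocallyIntegrable fun t => g t x) :
    ∀ᵐ t, ∀ᵐ x ∂μ, Tendsto (fun n : ℕ => ((n : ℝ) + 1) * ∫ u in t..t + 1 / (n + 1), g u x)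
      atTop (𝓝 (g t x)) := by
  set g' : ℝ → X → ℝ := curry (hg.mk _)
  have hg' : Measurable (uncurry g') := hg.stronglyMeasurable_mk.measurable
  have hgg' : ∀ᵐ t, ∀ᵐ x ∂μ, g t x = g' t x := Measure.ae_ae_of_ae_prod hg.ae_eq_mk
  have hgg'_swap : ∀ᵐ x ∂μ, ∀ᵐ t, g t x = g' t x := Measure.ae_ae_of_ae_prod
    (Measure.measurePreserving_swap (μ := μ).quasiMeasurePreserving.ae hg.ae_eq_mk)
  have hmeas : MeasurableSet {z : ℝ × X | Tendsto (fun n : ℕ => ((n : ℝ) + 1) *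
      ∫ u in z.1..z.1 + 1 / (n + 1), g' u z.2) atTop (𝓝 (g' z.1 z.2))} :=
    measurableSet_tendsto_fun
      (fun n => (measurable_intervalIntegral_translate hg' _).const_mul _) hg'
  have havg : ∀ᵐ t, ∀ᵐ x ∂μ, Tendsto (fun n : ℕ => ((n : ℝ) + 1) *
      ∫ u in t..t + 1 / (n + 1), g' u x) atTop (𝓝 (g' t x)) := by
    refine (Measure.ae_ae_comm hmeas).2 ?_
    filter_upwards [hgg'_swap, hloc] with x hx hxloc
    have hloc' : LocallyIntegrable fun t => g' t x := hxloc.congr hx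
    filter_upwards [LocallyIntegrable.ae_hasDerivAt_integral hloc'] with t ht
    simpa using tendsto_slope_one_div_nat (ht t)
  filter_upwards [havg, hgg'] with t ht ht'
  filter_upwards [ht, ht', hgg'_swap] with x hx hx' hx''
  rw [hx']
  refine hx.congr fun n => ?_
  rw [intervalIntegral.integral_congr_ae (hx''.mono fun u hu _ => hu)]

theorem ae_ae_tendsto_average_of_bound {X : Type*} [MeasurableSpace X] {μ : Measure X} [SFinite μ]
    {τ : ℝ} {g : ℝ → X → ℝ} {W : X → ℝ}
    (hg : AEStronglyMeasurable (uncurry g) ((volume.restrict (Ioc 0 τ)).prod μ))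
    (hgW : ∀ t ∈ Icc 0 τ, ∀ x, |g t x| ≤ W x) :
    ∀ᵐ t, t ∈ Ioo 0 τ → ∀ᵐ x ∂μ,
      Tendsto (fun n : ℕ => ((n : ℝ) + 1) * ∫ u in t..t + 1 / (n + 1), g u x)
        atTop (𝓝 (g t x)) := by
  set g' : ℝ → X → ℝ := fun t x => (Ioc 0 τ).indicator (fun t => g t x) t
  have hg'_eq : uncurry g' = (Ioc 0 τ ×ˢ univ).indicator (uncurry g) := by
    ext ⟨t, x⟩
    simp only [g', uncurry_apply_pair, indicator_apply, mem_prod, mem_univ, and_true]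
  have hg' : AEStronglyMeasurable (uncurry g') (volume.prod μ) := by
    rw [hg'_eq, aestronglyMeasurable_indicator_iff (measurableSet_Ioc.prod .univ),
      ← Measure.prod_restrict, Measure.restrict_univ]
    exact hg
  have hloc : ∀ᵐ x ∂μ, LocallyIntegrable fun t => g' t x := by
    have hsections : ∀ᵐ x ∂μ, AEStronglyMeasurable (fun t => g t x) (volume.restrict (Ioc 0 τ)) :=
      hg.prod_swap.prodMk_left
    filter_upwards [hsections] with x hx
    refine Integrable.locallyIntegrable ((integrable_indicator_iff measurableSet_Ioc).2 ?_)
    exact IntegrableOn.of_bound measure_Ioc_lt_top hx (W x)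
      ((ae_restrict_mem measurableSet_Ioc).mono fun t ht => hgW t (Ioc_subset_Icc_self ht) x)
  filter_upwards [ae_ae_tendsto_average hg' hloc] with t ht htτ
  have hlast : ∀ᶠ n : ℕ in atTop, t + 1 / ((n : ℝ) + 1) ≤ τ := by
    filter_upwards [tendsto_one_div_add_atTop_nhds_zero_nat.eventually_le_const (sub_pos.2 htτ.2)]
      with n hn using by linarith
  filter_upwards [ht] with x hx
  have hgt : g' t x = g t x := indicator_of_mem (Ioo_subset_Ioc_self htτ) _
  rw [← hgt]
  refine hx.congr' (hlast.mono fun n hn => ?_)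
  congr 1
  refine intervalIntegral.integral_congr fun u hu => indicator_of_mem ?_ _
  rw [uIcc_of_le (le_add_of_nonneg_right Nat.one_div_pos_of_nat.le)] at hu
  exact ⟨htτ.1.trans_le hu.1, hu.2.trans hn⟩

/-- Data for differentiating `t ↦ ∫ q t * w t` on `[0,τ]`: `q` is absolutely continuous in time with
derivative `g` dominated by `W`, and `t ↦ w t`, tested against a fixed `q s`, has derivative `F s`.
The two roles of time are separated because `w` has no derivative in a pointwise sense. -/
structure IsWeakPairing {X : Type*} [MeasurableSpace X] (μ : Measure X) (τ : ℝ) (q g w : ℝ → X → ℝ)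
    (W : X → ℝ) (F : ℝ → ℝ → ℝ) : Prop where
  aestronglyMeasurable : AEStronglyMeasurable (uncurry g) ((volume.restrict (Ioc 0 τ)).prod μ)
  abs_le : ∀ t ∈ Icc 0 τ, ∀ x, |g t x| ≤ W x
  integrable_bound : ∀ t ∈ Icc 0 τ, Integrable (fun x => W x * w t x) μ
  integrable : ∀ s ∈ Icc 0 τ, ∀ t ∈ Icc 0 τ, Integrable (fun x => q s x * w t x) μ
  sub_eq : ∀ᵐ x ∂μ, ∀ s ∈ Icc 0 τ, ∀ t ∈ Icc 0 τ, q t x - q s x = ∫ u in s..t, g u x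
  integral_sub_eq : ∀ t ∈ Icc 0 τ, ∀ r ∈ Icc 0 τ, ∀ s ∈ Icc 0 τ,
    (∫ x, q t x * w s x ∂μ) - (∫ x, q t x * w r x ∂μ) = ∫ u in r..s, F t u
  intervalIntegrable : ∀ t ∈ Icc 0 τ, IntervalIntegrable (F t) volume 0 τ
  intervalIntegrable_diag : IntervalIntegrable (fun t => F t t) volume 0 τ
  modulus : ∀ ε > 0, ∃ δ > 0, ∀ t ∈ Icc 0 τ, ∀ u ∈ Icc 0 τ, |t - u| < δ → |F t u - F u u| ≤ ε

namespace IsWeakPairing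

variable {X : Type*} [MeasurableSpace X] {μ : Measure X} {τ : ℝ} {q g w : ℝ → X → ℝ}
  {W : X → ℝ} {F : ℝ → ℝ → ℝ}

theorem integral_mul_sub_integral_mul (h : IsWeakPairing μ τ q g w W F) {s t : ℝ}
    (hs : s ∈ Icc 0 τ) (ht : t ∈ Icc 0 τ) :
    (∫ x, q t x * w t x ∂μ) - ∫ x, q s x * w s x ∂μ =
      (∫ x, (q t x - q s x) * w s x ∂μ) + ∫ u in s..t, F t u := by
  rw [← h.integral_sub_eq t ht s hs t ht]
  simp only [sub_mul]
  rw [integral_sub (h.integrable t ht s hs) (h.integrable s hs s hs)]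
  ring

theorem ae_abs_sub_mul_le (h : IsWeakPairing μ τ q g w W F) {s t : ℝ} (hs : s ∈ Icc 0 τ)
    (ht : t ∈ Icc 0 τ) : ∀ᵐ x ∂μ, |(q t x - q s x) * w s x| ≤ |t - s| * |W x * w s x| := by
  filter_upwards [h.sub_eq] with x hx
  have hW : 0 ≤ W x := (abs_nonneg _).trans (h.abs_le s hs x)
  have hsub : |q t x - q s x| ≤ W x * |t - s| := by
    rw [hx s hs t ht, ← Real.norm_eq_abs]
    exact intervalIntegral.norm_integral_le_of_norm_le_const fun u hu => h.abs_le u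
      ((convex_Icc 0 τ).ordConnected.uIcc_subset hs ht (uIoc_subset_uIcc hu)) x
  calc |(q t x - q s x) * w s x| = |q t x - q s x| * |w s x| := abs_mul _ _
    _ ≤ W x * |t - s| * |w s x| := by gcongr
    _ = |t - s| * |W x * w s x| := by rw [abs_mul, abs_of_nonneg hW]; ring

theorem abs_integral_mul_sub_integral_mul_le (h : IsWeakPairing μ τ q g w W F) {C D : ℝ}
    (hC : ∀ t ∈ Icc 0 τ, ∀ u ∈ Icc 0 τ, |F t u| ≤ C)
    (hD : ∀ t ∈ Icc 0 τ, ∫ x, |W x * w t x| ∂μ ≤ D) {s t : ℝ}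
    (hs : s ∈ Icc 0 τ) (ht : t ∈ Icc 0 τ) :
    |(∫ x, q t x * w t x ∂μ) - ∫ x, q s x * w s x ∂μ| ≤ (D + C) * |t - s| := by
  have hq : |∫ x, (q t x - q s x) * w s x ∂μ| ≤ D * |t - s| :=
    calc ‖∫ x, (q t x - q s x) * w s x ∂μ‖
      _ ≤ ∫ x, |t - s| * |W x * w s x| ∂μ :=
          norm_integral_le_of_norm_le ((h.integrable_bound s hs).abs.const_mul _)
            (h.ae_abs_sub_mul_le hs ht)
      _ ≤ D * |t - s| := by
          rw [integral_const_mul, mul_comm]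
          gcongr
          exact hD s hs
  have hF : ‖∫ u in s..t, F t u‖ ≤ C * |t - s| :=
    intervalIntegral.norm_integral_le_of_norm_le_const fun u hu => hC t ht u
      ((convex_Icc 0 τ).ordConnected.uIcc_subset hs ht (uIoc_subset_uIcc hu))
  rw [h.integral_mul_sub_integral_mul hs ht, add_mul]
  exact (abs_add_le _ _).trans (add_le_add hq hF)

theorem ae_tendsto_slope_left [SFinite μ] (h : IsWeakPairing μ τ q g w W F) :
    ∀ᵐ t, t ∈ Ioo 0 τ →
      Tendsto (fun n : ℕ => ((n : ℝ) + 1) * ∫ x, (q (t + 1 / (n + 1)) x - q t x) * w t x ∂μ) atTop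
        (𝓝 (∫ x, g t x * w t x ∂μ)) := by
  filter_upwards [ae_ae_tendsto_average_of_bound h.aestronglyMeasurable h.abs_le] with t hlim htτ
  have ht := Ioo_subset_Icc_self htτ
  have hlast : ∀ᶠ n : ℕ in atTop, t + 1 / ((n : ℝ) + 1) ∈ Icc 0 τ := by
    filter_upwards [tendsto_one_div_add_atTop_nhds_zero_nat.eventually_le_const (sub_pos.2 htτ.2)]
      with n hn using ⟨add_nonneg ht.1 Nat.one_div_pos_of_nat.le, by linarith⟩
  simp only [← integral_const_mul]
  refine tendsto_integral_filter_of_dominated_convergence (fun x => |W x * w t x|) ?_ ?_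
    (h.integrable_bound t ht).abs ?_
  · filter_upwards [hlast] with n hn
    simp only [sub_mul]
    exact (((h.integrable _ hn t ht).sub (h.integrable t ht t ht)).const_mul _).1
  · filter_upwards [hlast] with n hn
    filter_upwards [h.ae_abs_sub_mul_le ht hn] with x hx
    have hn' : (0 : ℝ) < n + 1 := by positivity
    rw [add_sub_cancel_left, abs_of_pos (Nat.one_div_pos_of_nat (α := ℝ))] at hx
    calc ‖((n : ℝ) + 1) * ((q (t + 1 / (n + 1)) x - q t x) * w t x)‖
        = ((n : ℝ) + 1) * |(q (t + 1 / (n + 1)) x - q t x) * w t x| := by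
          rw [norm_mul, Real.norm_of_nonneg hn'.le, Real.norm_eq_abs]
      _ ≤ ((n : ℝ) + 1) * (1 / (n + 1) * |W x * w t x|) := by gcongr
      _ = |W x * w t x| := by field_simp
  · filter_upwards [hlim htτ, h.sub_eq] with x hx hsub
    refine (hx.mul_const (w t x)).congr' (hlast.mono fun n hn => ?_)
    rw [← hsub t ht _ hn, mul_assoc]

theorem ae_tendsto_slope_right (h : IsWeakPairing μ τ q g w W F) :
    ∀ᵐ t, t ∈ Ioo 0 τ →
      Tendsto (fun n : ℕ => ((n : ℝ) + 1) * ∫ u in t..t + 1 / (n + 1), F (t + 1 / (n + 1)) u) atTop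
        (𝓝 (F t t)) := by
  filter_upwards [h.intervalIntegrable_diag.ae_hasDerivAt_integral] with t hderiv htτ
  have ht := Ioo_subset_Icc_self htτ
  have h0τ : (0 : ℝ) ≤ τ := ht.1.trans ht.2
  have hdiag : Tendsto (fun n : ℕ => ((n : ℝ) + 1) * ∫ u in t..t + 1 / (n + 1), F u u) atTop
      (𝓝 (F t t)) := by
    simpa using tendsto_slope_one_div_nat
      (hderiv (by rwa [uIcc_of_le h0τ]) t (by rwa [uIcc_of_le h0τ]))
  have hdiff : Tendsto (fun n : ℕ => ((n : ℝ) + 1) *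
      ∫ u in t..t + 1 / (n + 1), (F (t + 1 / (n + 1)) u - F u u)) atTop (𝓝 0) := by
    refine Metric.tendsto_nhds.2 fun ε hε => ?_
    obtain ⟨δ, hδ, hmod⟩ := h.modulus (ε / 2) (half_pos hε)
    filter_upwards [tendsto_one_div_add_atTop_nhds_zero_nat.eventually_lt_const
      (lt_min hδ (sub_pos.2 htτ.2))] with n hn
    obtain ⟨hnδ, hnτ⟩ := lt_min_iff.1 hn
    have hn0 : (0 : ℝ) < 1 / (n + 1) := Nat.one_div_pos_of_nat
    have hbound : ‖∫ u in t..t + 1 / ((n : ℝ) + 1), (F (t + 1 / (n + 1)) u - F u u)‖ ≤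
        ε / 2 * |t + 1 / (n + 1) - t| := by
      refine intervalIntegral.norm_integral_le_of_norm_le_const fun u hu => ?_
      rw [uIoc_of_le (by linarith)] at hu
      refine hmod _ ⟨by linarith [ht.1], by linarith⟩ u
        ⟨by linarith [ht.1, hu.1], by linarith [hu.2]⟩ ?_
      exact abs_lt.2 ⟨by linarith [hu.2], by linarith [hu.1]⟩
    rw [add_sub_cancel_left, abs_of_pos hn0] at hbound
    rw [dist_zero_right, norm_mul, Real.norm_of_nonneg (by positivity : (0 : ℝ) ≤ n + 1)]
    calc ((n : ℝ) + 1) * ‖∫ u in t..t + 1 / ((n : ℝ) + 1), (F (t + 1 / (n + 1)) u - F u u)‖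
      _ ≤ ((n : ℝ) + 1) * (ε / 2 * (1 / (n + 1))) := by gcongr
      _ = ε / 2 := by field_simp
      _ < ε := half_lt_self hε
  refine (zero_add (F t t) ▸ hdiff.add hdiag).congr' ?_
  filter_upwards [tendsto_one_div_add_atTop_nhds_zero_nat.eventually_le_const (sub_pos.2 htτ.2)]
    with n hn
  have hlast : t + 1 / ((n : ℝ) + 1) ∈ Icc 0 τ :=
    ⟨add_nonneg ht.1 Nat.one_div_pos_of_nat.le, by linarith⟩
  have hsub : uIcc t (t + 1 / ((n : ℝ) + 1)) ⊆ uIcc 0 τ := by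
    rw [uIcc_of_le h0τ]
    exact (convex_Icc 0 τ).ordConnected.uIcc_subset ht hlast
  rw [intervalIntegral.integral_sub ((h.intervalIntegrable _ hlast).mono_set hsub)
    (h.intervalIntegrable_diag.mono_set hsub)]
  ring

theorem integral_eq_sub [SFinite μ] (h : IsWeakPairing μ τ q g w W F) (hτ : 0 ≤ τ) {C D : ℝ}
    (hC : ∀ t ∈ Icc 0 τ, ∀ u ∈ Icc 0 τ, |F t u| ≤ C)
    (hD : ∀ t ∈ Icc 0 τ, ∫ x, |W x * w t x| ∂μ ≤ D) :
    ∫ t in 0..τ, ((∫ x, g t x * w t x ∂μ) + F t t) =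
      (∫ x, q τ x * w τ x ∂μ) - ∫ x, q 0 x * w 0 x ∂μ := by
  refine integral_eq_sub_of_lipschitzOnWith (K := (D + C).toNNReal)
    (Φ := fun t => ∫ x, q t x * w t x ∂μ) hτ ?_ ?_
  · refine LipschitzOnWith.of_dist_le_mul fun t ht s hs => ?_
    exact (h.abs_integral_mul_sub_integral_mul_le hC hD hs ht).trans
      (mul_le_mul_of_nonneg_right (Real.le_coe_toNNReal _) (abs_nonneg _))
  · filter_upwards [h.ae_tendsto_slope_left, h.ae_tendsto_slope_right] with t hleft hright htτ
    have ht := Ioo_subset_Icc_self htτ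
    refine ((hleft htτ).add (hright htτ)).congr' ?_
    filter_upwards [tendsto_one_div_add_atTop_nhds_zero_nat.eventually_le_const (sub_pos.2 htτ.2)]
      with n hn
    rw [h.integral_mul_sub_integral_mul ht
      ⟨add_nonneg ht.1 Nat.one_div_pos_of_nat.le, by linarith⟩, mul_add]

end IsWeakPairing

end PairingCalculus

section QuadraticJet

open Filter Topology

variable {E : Type*} [NormedAddCommGroup E] [NormedSpace ℝ E]

/-- `f` is `C²` and its derivatives of order `i ≤ 2` grow at most like `(1 + ‖x‖) ^ (2 - i)`: this
is the class of test functions that a curve with finite second moments can be paired with. -/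
structure HasQuadraticJet (B : ℝ) (f : E → ℝ) : Prop where
  contDiff : ContDiff ℝ 2 f
  norm_iteratedFDeriv_le : ∀ i ≤ 2, ∀ x, ‖iteratedFDeriv ℝ i f x‖ ≤ B * (1 + ‖x‖) ^ (2 - i)

theorem HasQuadraticJet.abs_le {B : ℝ} {f : E → ℝ} (hf : HasQuadraticJet B f) (x : E) :
    |f x| ≤ B * (1 + ‖x‖) ^ 2 := by
  simpa using hf.norm_iteratedFDeriv_le 0 zero_le_two x

theorem HasQuadraticJet.mul {B C : ℝ} {f χ : E → ℝ} (hf : HasQuadraticJet B f)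
    (hχ : ContDiff ℝ 2 χ) (hC : ∀ i ≤ 2, ∀ x, (1 + ‖x‖) ^ i * ‖iteratedFDeriv ℝ i χ x‖ ≤ C) :
    HasQuadraticJet (4 * C * B) fun x => χ x * f x := by
  refine ⟨hχ.mul hf.contDiff, fun i hi x => ?_⟩
  have hB : 0 ≤ B := by
    simpa using (norm_nonneg _).trans (hf.norm_iteratedFDeriv_le 0 zero_le_two 0)
  have hC0 : 0 ≤ C := le_trans (by positivity) (hC 0 zero_le_two 0)
  have hterm : ∀ k ∈ Finset.range (i + 1),
      (i.choose k : ℝ) * ‖iteratedFDeriv ℝ k χ x‖ * ‖iteratedFDeriv ℝ (i - k) f x‖ ≤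
        (i.choose k : ℝ) * (C * B * (1 + ‖x‖) ^ (2 - i)) := by
    intro k hk
    have hki : k ≤ i := Finset.mem_range_succ_iff.1 hk
    calc (i.choose k : ℝ) * ‖iteratedFDeriv ℝ k χ x‖ * ‖iteratedFDeriv ℝ (i - k) f x‖
      _ ≤ (i.choose k : ℝ) * ‖iteratedFDeriv ℝ k χ x‖ * (B * (1 + ‖x‖) ^ (2 - (i - k))) := by
          gcongr
          exact hf.norm_iteratedFDeriv_le _ (by omega) x
      _ = (i.choose k : ℝ) *
            ((1 + ‖x‖) ^ k * ‖iteratedFDeriv ℝ k χ x‖ * B * (1 + ‖x‖) ^ (2 - i)) := by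
          rw [show 2 - (i - k) = k + (2 - i) by omega, pow_add]
          ring
      _ ≤ (i.choose k : ℝ) * (C * B * (1 + ‖x‖) ^ (2 - i)) := by
          gcongr
          exact hC k (hki.trans hi) x
  calc ‖iteratedFDeriv ℝ i (fun x => χ x * f x) x‖
    _ ≤ ∑ k ∈ Finset.range (i + 1),
          (i.choose k : ℝ) * ‖iteratedFDeriv ℝ k χ x‖ * ‖iteratedFDeriv ℝ (i - k) f x‖ :=
        norm_iteratedFDeriv_mul_le hχ hf.contDiff x (by exact_mod_cast hi)
    _ ≤ ∑ k ∈ Finset.range (i + 1), (i.choose k : ℝ) * (C * B * (1 + ‖x‖) ^ (2 - i)) :=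
        Finset.sum_le_sum hterm
    _ = 2 ^ i * (C * B * (1 + ‖x‖) ^ (2 - i)) := by
        rw [← Finset.sum_mul, ← Nat.cast_sum, Nat.sum_range_choose, Nat.cast_pow, Nat.cast_ofNat]
    _ ≤ 2 ^ 2 * (C * B * (1 + ‖x‖) ^ (2 - i)) := by
        gcongr
        exact one_le_two
    _ = 4 * C * B * (1 + ‖x‖) ^ (2 - i) := by ring

variable [FiniteDimensional ℝ E]

/-- The smooth cutoff `χ(x / (n + 1))`, where `χ = 1` on the unit ball and `χ = 0` outside the ball
of radius `2`. -/
noncomputable def cutoff (n : ℕ) (x : E) : ℝ :=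
  (⟨1, 2, one_pos, one_lt_two⟩ : ContDiffBump (0 : E)) (((n : ℝ) + 1)⁻¹ • x)

theorem contDiff_cutoff (n : ℕ) {k : ℕ∞} : ContDiff ℝ k (cutoff n : E → ℝ) :=
  (ContDiffBump.contDiff _).comp (contDiff_const_smul _)

theorem hasCompactSupport_cutoff (n : ℕ) : HasCompactSupport (cutoff n : E → ℝ) :=
  (ContDiffBump.hasCompactSupport _).comp_smul (by positivity)

theorem eventually_cutoff_eventuallyEq_one (x : E) : ∀ᶠ n : ℕ in atTop, cutoff n =ᶠ[𝓝 x] 1 := by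
  filter_upwards [tendsto_natCast_atTop_atTop.eventually_ge_atTop ‖x‖] with n hn
  filter_upwards [continuous_norm.continuousAt.eventually_lt_const (hn.trans_lt (lt_add_one _))]
    with y hy
  refine ContDiffBump.one_of_mem_closedBall _ (mem_closedBall_zero_iff.2 ?_)
  rw [norm_smul, norm_inv, Real.norm_of_nonneg (by positivity), inv_mul_le_one₀ (by positivity)]
  exact hy.le

variable (E) in
theorem exists_norm_iteratedFDeriv_cutoff_le (k : ℕ) : ∃ C, ∀ (n : ℕ), ∀ i ≤ k, ∀ x : E,
      (1 + ‖x‖) ^ i * ‖iteratedFDeriv ℝ i (cutoff n : E → ℝ) x‖ ≤ C := by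
  set χ : ContDiffBump (0 : E) := ⟨1, 2, one_pos, one_lt_two⟩
  have hbound (i : ℕ) : ∃ C, ∀ x, ‖(1 + ‖x‖) ^ i * ‖iteratedFDeriv ℝ i χ x‖‖ ≤ C := by
    have hcont : Continuous (iteratedFDeriv ℝ i χ) :=
      χ.contDiff.continuous_iteratedFDeriv (m := i) (n := ∞) (by exact_mod_cast le_top)
    exact Continuous.bounded_above_of_compact_support (by fun_prop)
      ((χ.hasCompactSupport.iteratedFDeriv i).norm.mul_left)
  choose C hC using hbound
  refine ⟨∑ i ∈ Finset.range (k + 1), C i, fun n i hi x => ?_⟩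
  have hC0 (i : ℕ) : 0 ≤ C i := (norm_nonneg _).trans (hC i 0)
  have hc0 : (0 : ℝ) < (n : ℝ) + 1 := by positivity
  have hc1 : ((n : ℝ) + 1)⁻¹ ≤ 1 := inv_le_one_of_one_le₀ (by simp)
  set c : ℝ := ((n : ℝ) + 1)⁻¹
  have hscale : c * (1 + ‖x‖) ≤ 1 + ‖c • x‖ := by
    rw [norm_smul, Real.norm_of_nonneg (inv_pos.2 hc0).le]
    linarith
  have hderiv : iteratedFDeriv ℝ i (cutoff n) x = c ^ i • iteratedFDeriv ℝ i χ (c • x) :=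
    congr_fun (iteratedFDeriv_comp_const_smul c (χ.contDiff (n := i))) x
  calc (1 + ‖x‖) ^ i * ‖iteratedFDeriv ℝ i (cutoff n) x‖
    _ = (c * (1 + ‖x‖)) ^ i * ‖iteratedFDeriv ℝ i χ (c • x)‖ := by
        rw [hderiv, norm_smul, norm_pow, Real.norm_of_nonneg (inv_pos.2 hc0).le, mul_pow]
        ring
    _ ≤ (1 + ‖c • x‖) ^ i * ‖iteratedFDeriv ℝ i χ (c • x)‖ := by gcongr
    _ ≤ C i := (le_abs_self _).trans (hC i _)
    _ ≤ ∑ i ∈ Finset.range (k + 1), C i :=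
        Finset.single_le_sum (fun i _ => hC0 i) (Finset.mem_range_succ_iff.2 hi)

end QuadraticJet

theorem isCb2_of_hasCompactSupport {d : ℕ} {f : Pt d → ℝ} (hf : ContDiff ℝ 2 f)
    (hsupp : HasCompactSupport f) : IsCb2 f := by
  obtain ⟨C₀, hC₀⟩ := hf.continuous.bounded_above_of_compact_support hsupp
  obtain ⟨C₁, hC₁⟩ := (hf.continuous_fderiv two_ne_zero).bounded_above_of_compact_support
    (hsupp.fderiv ℝ)
  obtain ⟨C₂, hC₂⟩ := (hf.continuous_iteratedFDeriv le_rfl).bounded_above_of_compact_support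
    (hsupp.iteratedFDeriv 2)
  refine ⟨hf, max C₀ (max C₁ C₂), fun x => ⟨le_max_of_le_left (hC₀ x), ?_, ?_⟩⟩
  · exact le_max_of_le_right (le_max_of_le_left (hC₁ x))
  · exact le_max_of_le_right (le_max_of_le_right (hC₂ x))

theorem norm_gradient_eq_norm_iteratedFDeriv_one {d : ℕ} (f : Pt d → ℝ) (x : Pt d) :
    ‖gradient f x‖ = ‖iteratedFDeriv ℝ 1 f x‖ := by
  rw [norm_iteratedFDeriv_one, gradient, LinearIsometryEquiv.norm_map]

theorem continuous_gradient_of_contDiff {d : ℕ} {f : Pt d → ℝ} (hf : ContDiff ℝ 2 f) :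
    Continuous (gradient f) :=
  (InnerProductSpace.toDual ℝ (Pt d)).symm.continuous.comp (hf.continuous_fderiv two_ne_zero)

/-! ### Growth and measurability of the data -/

section WeightedDensity

open Filter

variable {d : ℕ}

theorem integrable_mul_of_abs_le {α : Type*} [MeasurableSpace α] {μ : Measure α} {φ W u : α → ℝ}
    {C : ℝ} (hW : Integrable (fun x => W x * u x) μ) (hφ : AEStronglyMeasurable φ μ)
    (hu : AEStronglyMeasurable u μ) (h : ∀ᵐ x ∂μ, |φ x| ≤ C * W x) :
    Integrable (fun x => φ x * u x) μ := by
  refine (hW.norm.const_mul |C|).mono' (hφ.mul hu) ?_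
  filter_upwards [h] with x hx
  rw [norm_mul, norm_mul, Real.norm_eq_abs, ← mul_assoc, Real.norm_eq_abs (W x), ← abs_mul]
  exact mul_le_mul_of_nonneg_right (hx.trans (le_abs_self _)) (abs_nonneg _)

theorem IsDensity2.integrable_weight {u : Pt d → ℝ} (hu : IsDensity2 u) :
    Integrable fun x => (1 + ‖x‖) ^ 2 * u x := by
  have h : Integrable fun x => (1 + ‖x‖ ^ 2) * u x := by
    simp only [add_mul, one_mul]
    exact hu.integrable.add hu.secondMoment
  refine integrable_mul_of_abs_le (C := 2) h (by fun_prop) hu.measurable.aestronglyMeasurable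
    (Eventually.of_forall fun x => ?_)
  rw [abs_of_nonneg (by positivity)]
  nlinarith [sq_nonneg (1 - ‖x‖)]

theorem IsDensity2.integral_weight_le {u : Pt d → ℝ} (hu : IsDensity2 u) :
    ∫ x, (1 + ‖x‖) ^ 2 * u x ≤ 2 * (1 + ∫ x, ‖x‖ ^ 2 * u x) := by
  have h := integral_add hu.integrable hu.secondMoment
  rw [hu.integral_eq_one] at h
  rw [← h, ← integral_const_mul]
  refine integral_mono hu.integrable_weight ((hu.integrable.add hu.secondMoment).const_mul 2)
    fun x => ?_
  have := hu.nonneg x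
  nlinarith [mul_nonneg (sq_nonneg (1 - ‖x‖)) this]

theorem IsDensity2.integrable_mul {u φ : Pt d → ℝ} (hu : IsDensity2 u) {C : ℝ}
    (hφ : AEStronglyMeasurable φ) (h : ∀ x, |φ x| ≤ C * (1 + ‖x‖) ^ 2) :
    Integrable fun x => φ x * u x :=
  integrable_mul_of_abs_le hu.integrable_weight hφ hu.measurable.aestronglyMeasurable
    (Eventually.of_forall h)

theorem abs_apply_le_frobNorm (B : Matrix (Fin d) (Fin d) ℝ) (i k : Fin d) :
    |B i k| ≤ frobNorm B := by
  rw [← Real.sqrt_sq_eq_abs]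
  refine Real.sqrt_le_sqrt ?_
  calc B i k ^ 2 ≤ ∑ k, B i k ^ 2 :=
        Finset.single_le_sum (f := fun k => B i k ^ 2) (fun _ _ => sq_nonneg _) (Finset.mem_univ k)
    _ ≤ _ := Finset.single_le_sum (f := fun i => ∑ k, B i k ^ 2)
        (fun _ _ => Finset.sum_nonneg fun _ _ => sq_nonneg _) (Finset.mem_univ i)

theorem frobNorm_nonneg (B : Matrix (Fin d) (Fin d) ℝ) : 0 ≤ frobNorm B := Real.sqrt_nonneg _

end WeightedDensity

namespace CrowdModel

open Function Filter Topology

section Data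

variable {d M : ℕ} {S : CrowdModel d M}

theorem Standing.exists_growth (hS : S.Standing) : ∃ K : ℝ, 0 ≤ K ∧ ∀ t ∈ Icc 0 S.T, ∀ x : Pt d,
    ∀ α ∈ convexHull ℝ S.A, ‖α‖ ≤ K ∧ ‖S.b t x α‖ ≤ K * (1 + ‖x‖) ∧
      (∀ i k, |S.σ t x i k| ≤ K * (1 + ‖x‖)) ∧
      ∀ α' ∈ convexHull ℝ S.A, ‖S.b t x α' - S.b t x α‖ ≤ K * ‖α' - α‖ := by
  obtain ⟨K, hK, h⟩ := hS.lipschitz_growth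
  obtain ⟨R, hR⟩ := (isBounded_convexHull.2 hS.compact_A.isBounded).exists_norm_le
  refine ⟨max R 0 + K * (1 + max R 0), by positivity, fun t ht x α hα => ?_⟩
  have hR' : ‖α‖ ≤ max R 0 := (hR α hα).trans (le_max_left _ _)
  have hR0 : 0 ≤ max R 0 := le_max_right _ _
  set R' := max R 0
  have hgrowth := (h t ht x x α hα α hα).2.2
  have hbig : K * (1 + ‖x‖ + ‖α‖) ≤ (R' + K * (1 + R')) * (1 + ‖x‖) := by
    have : K * (1 + ‖x‖ + ‖α‖) ≤ K * (1 + ‖x‖ + R') := by gcongr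
    have : 0 ≤ K * R' * ‖x‖ := by positivity
    have : 0 ≤ R' * ‖x‖ := by positivity
    nlinarith
  refine ⟨?_, ?_, fun i k => ?_, fun α' hα' => ?_⟩
  · have : 0 ≤ K * (1 + R') := by positivity
    linarith
  · linarith [frobNorm_nonneg (S.σ t x)]
  · linarith [abs_apply_le_frobNorm (S.σ t x) i k, norm_nonneg (S.b t x α)]
  · have := (h t ht x x α' hα' α hα).1
    rw [sub_self, norm_zero, zero_add] at this
    refine this.trans ?_
    gcongr
    nlinarith

theorem IsControl.mem_hull {a : ℝ → Pt d → Pt d} (ha : S.IsControl a) (t : ℝ) (x : Pt d) :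
    a t x ∈ convexHull ℝ S.A := subset_convexHull ℝ _ (ha.2 t x)

/-- Lebesgue measure on the open time interval `(0,T)`. -/
noncomputable def timeVol (S : CrowdModel d M) : Measure ℝ := volume.restrict (Ioo 0 S.T)

instance : IsFiniteMeasure S.timeVol :=
  ⟨by simp [timeVol]⟩

theorem timeVol_prod : S.timeVol.prod (volume : Measure (Pt d)) =
    (volume : Measure (ℝ × Pt d)).restrict (Ioo 0 S.T ×ˢ univ) := by
  conv_lhs => rw [timeVol, ← Measure.restrict_univ (μ := (volume : Measure (Pt d))),
    Measure.prod_restrict]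
  rfl

theorem ae_timeVol {P : ℝ → Prop} (h : ∀ t ∈ Ioo 0 S.T, P t) : ∀ᵐ t ∂S.timeVol, P t :=
  (ae_restrict_mem measurableSet_Ioo).mono h

theorem ae_timeVol_prod {P : ℝ × Pt d → Prop} (h : ∀ t ∈ Ioo 0 S.T, ∀ x, P (t, x)) :
    ∀ᵐ z ∂(S.timeVol.prod volume), P z := by
  rw [timeVol_prod]
  exact (ae_restrict_mem (measurableSet_Ioo.prod .univ)).mono fun z hz => h z.1 hz.1 z.2

theorem intervalIntegral_eq_timeVol (hT : 0 ≤ S.T) (f : ℝ → ℝ) :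
    ∫ t in (0 : ℝ)..S.T, f t = ∫ t, f t ∂S.timeVol := by
  rw [intervalIntegral.integral_of_le hT, integral_Ioc_eq_integral_Ioo, timeVol]

theorem aestronglyMeasurable_of_continuousOn_Ico {β : Type*} [TopologicalSpace β]
    [TopologicalSpace.PseudoMetrizableSpace β] [SecondCountableTopology β]
    {f : ℝ × Pt d → β} (hf : ContinuousOn f (Ico 0 S.T ×ˢ univ)) :
    AEStronglyMeasurable f (S.timeVol.prod volume) := by
  rw [timeVol_prod]
  exact (hf.mono (prod_mono_left Ioo_subset_Ico_self)).aestronglyMeasurable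
    (measurableSet_Ioo.prod .univ)

theorem Standing.measurable_drift_comp (hS : S.Standing) {Z : Type*} [MeasurableSpace Z]
    {τ : Z → ℝ} {y α : Z → Pt d} (hτ : Measurable τ) (hy : Measurable y) (hα : Measurable α)
    (hτ' : ∀ z, τ z ∈ Icc 0 S.T) (hα' : ∀ z, α z ∈ convexHull ℝ S.A) :
    Measurable fun z => S.b (τ z) (y z) (α z) := by
  have h := (continuousOn_iff_continuous_domRestrict.1 hS.b_continuous).measurable
  have hz : Measurable fun z => (⟨(τ z, y z, α z), hτ' z, mem_univ _, hα' z⟩ :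
      (Icc 0 S.T ×ˢ ((univ : Set (Pt d)) ×ˢ convexHull ℝ S.A) : Set (ℝ × Pt d × Pt d))) :=
    Measurable.subtype_mk (hτ.prodMk (hy.prodMk hα))
  exact h.comp hz

theorem Standing.measurable_drift (hS : S.Standing) {t : ℝ} (ht : t ∈ Icc 0 S.T)
    {a : Pt d → Pt d} (ha : Measurable a) (hmem : ∀ x, a x ∈ convexHull ℝ S.A) :
    Measurable fun x => S.b t x (a x) :=
  hS.measurable_drift_comp measurable_const measurable_id ha (fun _ => ht) hmem

theorem Standing.aestronglyMeasurable_drift (hS : S.Standing) {a : ℝ → Pt d → Pt d}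
    (ha : S.IsControl a) :
    AEStronglyMeasurable (fun z : ℝ × Pt d => S.b z.1 z.2 (a z.1 z.2)) (S.timeVol.prod volume) := by
  have h := hS.measurable_drift_comp (Z := ℝ × Pt d)
    (τ := fun z => (projIcc 0 S.T hS.T_pos.le z.1 : ℝ)) (y := fun z => z.2)
    (α := fun z => a z.1 z.2) ((continuous_subtype_val.comp
      (continuous_projIcc.comp continuous_fst)).measurable) measurable_snd ha.1
    (fun z => Subtype.coe_prop _) fun z => ha.mem_hull _ _
  refine h.aestronglyMeasurable.congr (ae_timeVol_prod fun t ht x => ?_)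
  simp only [projIcc_of_mem hS.T_pos.le (Ioo_subset_Icc_self ht)]

theorem measurable_ballIndicator : Measurable S.ballIndicator :=
  measurable_const.indicator measurableSet_ball

theorem integrable_ballIndicator : Integrable S.ballIndicator :=
  (integrable_indicator_iff measurableSet_ball).2
    (integrableOn_const measure_ball_lt_top.ne)

theorem Standing.continuous_mollifier (hS : S.Standing) : Continuous S.mollifier := by
  have := hS.γ_smooth.continuous
  unfold mollifier
  fun_prop

theorem Standing.exists_kernel_bound (hS : S.Standing) : ∃ C, 0 ≤ C ∧ ∀ x, |S.kernel x| ≤ C := by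
  obtain ⟨C, hC⟩ : ∃ C, ∀ x, ‖S.γ x‖ ≤ C :=
    hS.γ_smooth.continuous.bounded_above_of_compact_support hS.γ_compactSupport
  refine ⟨|(S.δ ^ d)⁻¹| * |C| * ∫ y, ‖S.ballIndicator y‖, by positivity, fun x => ?_⟩
  rw [← integral_const_mul]
  change ‖∫ y, S.mollifier (x - y) * S.ballIndicator y‖ ≤ _
  refine norm_integral_le_of_norm_le (integrable_ballIndicator.norm.const_mul _)
    (Eventually.of_forall fun y => ?_)
  simp only [mollifier, norm_mul, Real.norm_eq_abs]
  exact mul_le_mul_of_nonneg_right (mul_le_mul_of_nonneg_left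
    ((hC _).trans (le_abs_self C)) (abs_nonneg _)) (abs_nonneg _)

theorem Standing.measurable_kernel (hS : S.Standing) : Measurable S.kernel := by
  have hmollifier := hS.continuous_mollifier.measurable
  have hball := measurable_ballIndicator (S := S)
  refine StronglyMeasurable.measurable ?_
  refine StronglyMeasurable.integral_prod_right
    (f := fun x y => S.mollifier (x - y) * S.ballIndicator y) ?_
  refine Measurable.stronglyMeasurable ?_
  fun_prop

theorem Standing.kernel_neg (hS : S.Standing) (x : Pt d) : S.kernel (-x) = S.kernel x := by
  unfold kernel
  rw [← integral_neg_eq_self]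
  congr 1
  funext y
  have hball : S.ballIndicator (-y) = S.ballIndicator y := by
    simp [ballIndicator, indicator]
  have hmollifier : S.mollifier (-x - -y) = S.mollifier (x - y) := by
    rw [show -x - -y = -(x - y) by abel, mollifier, mollifier, smul_neg, hS.γ_symm]
  rw [hball, hmollifier]

theorem Standing.integrable_kernel_mul (hS : S.Standing) {u : Pt d → ℝ} (hu : Integrable u)
    (x : Pt d) : Integrable fun y => S.kernel (x - y) * u y := by
  obtain ⟨C, -, hC⟩ := hS.exists_kernel_bound
  have hk := hS.measurable_kernel
  exact hu.bdd_mul (c := C)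
    (by fun_prop : Measurable fun y => S.kernel (x - y)).aestronglyMeasurable
    (Eventually.of_forall fun y => hC _)

theorem Standing.exists_G_bound (hS : S.Standing) : ∃ C, 0 ≤ C ∧
    ∀ (m : Fin M → Pt d → ℝ) (j : Fin M), IsDensity2 (m j) → ∀ x, |S.G m x j| ≤ C := by
  obtain ⟨C, hC0, hC⟩ := hS.exists_kernel_bound
  refine ⟨C, hC0, fun m j hm x => ?_⟩
  have : ‖∫ y, S.kernel (x - y) * m j y‖ ≤ ∫ y, C * m j y := by
    refine norm_integral_le_of_norm_le (hm.integrable.const_mul C)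
      (Eventually.of_forall fun y => ?_)
    rw [norm_mul, Real.norm_of_nonneg (hm.nonneg y)]
    exact mul_le_mul_of_nonneg_right (hC _) (hm.nonneg y)
  rwa [integral_const_mul, hm.integral_eq_one, mul_one] at this

theorem Standing.measurable_G (hS : S.Standing) {m : Fin M → ℝ → Pt d → ℝ} (j : Fin M)
    (hm : Measurable (uncurry (m j))) :
    Measurable fun z : ℝ × Pt d => S.G (fun k => m k z.1) z.2 j := by
  have hk := hS.measurable_kernel
  have hm' : Measurable fun z : ℝ × Pt d => m j z.1 z.2 := hm
  refine StronglyMeasurable.measurable ?_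
  refine StronglyMeasurable.integral_prod_right
    (f := fun (z : ℝ × Pt d) y => S.kernel (z.2 - y) * m j z.1 y) ?_
  refine Measurable.stronglyMeasurable ?_
  have hdensity : Measurable fun z : (ℝ × Pt d) × Pt d => m j z.1.1 z.2 :=
    hm'.comp (by fun_prop : Measurable fun z : (ℝ × Pt d) × Pt d => (z.1.1, z.2))
  have hkernel : Measurable fun z : (ℝ × Pt d) × Pt d => S.kernel (z.1.2 - z.2) := by fun_prop
  exact hkernel.mul hdensity

theorem Standing.measurable_G_profile (hS : S.Standing) {m : Fin M → Pt d → ℝ} (j : Fin M)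
    (hm : Measurable (m j)) : Measurable fun x => S.G m x j := by
  have hk := hS.measurable_kernel
  have h : StronglyMeasurable fun z : Pt d × Pt d => S.kernel (z.1 - z.2) * m j z.2 :=
    Measurable.stronglyMeasurable (by fun_prop)
  exact h.integral_prod_right'.measurable

theorem Standing.integral_G_mul_comm (hS : S.Standing) {m n : Fin M → Pt d → ℝ} {j k : Fin M}
    (hm : Integrable (m j)) (hn : Integrable (n k)) :
    ∫ x, S.G m x j * n k x = ∫ x, m j x * S.G n x k := by
  obtain ⟨C, -, hC⟩ := hS.exists_kernel_bound
  have hI : Integrable (fun z : Pt d × Pt d => S.kernel (z.1 - z.2) * (n k z.1 * m j z.2))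
      (volume.prod volume) := by
    have hk := hS.measurable_kernel
    exact (hn.mul_prod hm).bdd_mul (c := C)
      (by fun_prop : Measurable fun z : Pt d × Pt d => S.kernel (z.1 - z.2)).aestronglyMeasurable
      (Eventually.of_forall fun y => hC _)
  have hleft : ∀ x, S.G m x j * n k x = ∫ y, S.kernel (x - y) * (n k x * m j y) := fun x => by
    rw [G, ← integral_mul_const]
    refine integral_congr_ae (Eventually.of_forall fun y => ?_)
    simp only []
    ring
  have hright : ∀ y, m j y * S.G n y k = ∫ x, S.kernel (x - y) * (n k x * m j y) := fun y => by
    rw [G, ← integral_const_mul]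
    refine integral_congr_ae (Eventually.of_forall fun x => ?_)
    simp only []
    rw [show x - y = -(y - x) by abel, hS.kernel_neg]
    ring
  simp_rw [hleft, hright]
  exact integral_integral_swap hI

theorem Standing.continuous_terminalCost (hS : S.Standing) (j : Fin M) : Continuous (S.Ψ j) := by
  obtain ⟨K, hK, h⟩ := hS.Ψ_lipschitz
  refine (LipschitzWith.of_dist_le_mul (K := ⟨K, hK.le⟩) fun x y => ?_).continuous
  rw [Real.dist_eq, dist_eq_norm]
  exact h j x y

end Data

section StateAdjoint

variable {d M : ℕ} {S : CrowdModel d M} {a : Fin M → ℝ → Pt d → Pt d} {m p : Fin M → ℝ → Pt d → ℝ}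

theorem IsState.exists_integral_weight_le (hm : S.IsState a m) (j : Fin M) :
    ∃ D, ∀ t ∈ Icc 0 S.T, ∫ x, (1 + ‖x‖) ^ 2 * m j t x ≤ D := by
  obtain ⟨C, hC⟩ := isCompact_Icc.exists_bound_of_continuousOn (hm.moment_continuous j)
  refine ⟨2 * (1 + C), fun t ht => (hm.density j t ht).integral_weight_le.trans ?_⟩
  have := (le_abs_self _).trans (hC t ht)
  linarith

theorem IsState.integrable_weight (hm : S.IsState a m) (j : Fin M) :
    Integrable (fun z : ℝ × Pt d => (1 + ‖z.2‖) ^ 2 * m j z.1 z.2) (S.timeVol.prod volume) := by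
  have hmeas : Measurable fun z : ℝ × Pt d => m j z.1 z.2 := hm.measurable j
  have hsm : StronglyMeasurable fun z : ℝ × Pt d => (1 + ‖z.2‖) ^ 2 * m j z.1 z.2 :=
    Measurable.stronglyMeasurable (by fun_prop)
  rw [integrable_prod_iff hsm.aestronglyMeasurable]
  refine ⟨ae_timeVol fun t ht =>
    (hm.density j t (Ioo_subset_Icc_self ht)).integrable_weight, ?_⟩
  obtain ⟨D, hD⟩ := hm.exists_integral_weight_le j
  refine Integrable.of_bound (C := D) hsm.norm.integral_prod_right'.aestronglyMeasurable
    (ae_timeVol fun t ht => ?_)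
  have hnonneg : ∀ x, 0 ≤ (1 + ‖x‖) ^ 2 * m j t x := fun x =>
    mul_nonneg (by positivity) ((hm.density j t (Ioo_subset_Icc_self ht)).nonneg x)
  simp only [Real.norm_of_nonneg (hnonneg _), Real.norm_of_nonneg (integral_nonneg hnonneg)]
  exact hD t (Ioo_subset_Icc_self ht)

theorem IsState.integrable_mul (hm : S.IsState a m) (j : Fin M) {φ : ℝ → Pt d → ℝ} {C : ℝ}
    (hφ : AEStronglyMeasurable (uncurry φ) (S.timeVol.prod volume))
    (h : ∀ t ∈ Ioo 0 S.T, ∀ x, |φ t x| ≤ C * (1 + ‖x‖) ^ 2) :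
    Integrable (fun z : ℝ × Pt d => φ z.1 z.2 * m j z.1 z.2) (S.timeVol.prod volume) :=
  integrable_mul_of_abs_le (hm.integrable_weight j) hφ (hm.measurable j).aestronglyMeasurable
    (ae_timeVol_prod h)

theorem abs_le_of_norm_gradient_le {f : Pt d → ℝ} {C : ℝ} (hf : Differentiable ℝ f)
    (hC : ∀ x, ‖gradient f x‖ ≤ C * (1 + ‖x‖)) (x : Pt d) :
    |f x| ≤ (|f 0| + C) * (1 + ‖x‖) ^ 2 := by
  have hC0 : 0 ≤ C := by simpa using (norm_nonneg _).trans (hC 0)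
  have hx := norm_nonneg x
  have hmean : ‖f x - f 0‖ ≤ C * (1 + ‖x‖) * ‖x - 0‖ := by
    refine (convex_closedBall (0 : Pt d) ‖x‖).norm_image_sub_le_of_norm_fderiv_le (𝕜 := ℝ)
      (fun y _ => hf y) (fun y hy => ?_) (by simp) (by simp)
    calc ‖fderiv ℝ f y‖ = ‖gradient f y‖ := by rw [gradient, LinearIsometryEquiv.norm_map]
      _ ≤ C * (1 + ‖y‖) := hC y
      _ ≤ C * (1 + ‖x‖) := by have := mem_closedBall_zero_iff.1 hy; gcongr
  rw [sub_zero, Real.norm_eq_abs] at hmean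
  have hsplit : |f x| ≤ |f 0| + C * (1 + ‖x‖) * ‖x‖ := by
    linarith [abs_sub_abs_le_abs_sub (f x) (f 0)]
  nlinarith [mul_nonneg hC0 hx, mul_nonneg (abs_nonneg (f 0)) hx,
    mul_nonneg (abs_nonneg (f 0)) (sq_nonneg ‖x‖)]

theorem IsAdjoint.exists_growth (hp : S.IsAdjoint a m p) :
    ∃ C, 0 ≤ C ∧ ∀ j, ∀ t ∈ Ico 0 S.T, ∀ x, ‖gradient (p j t) x‖ ≤ C * (1 + ‖x‖) ∧
      |p j t x| ≤ C * (1 + ‖x‖) ^ 2 := by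
  obtain ⟨C, hC⟩ := hp.gradient_growth
  have horigin : ∀ j, ∃ D, ∀ t ∈ Icc 0 S.T, ‖p j t 0‖ ≤ D := fun j =>
    isCompact_Icc.exists_bound_of_continuousOn (f := fun t => p j t 0) <|
      (hp.continuous j).comp (f := fun t : ℝ => (t, (0 : Pt d))) (by fun_prop)
        fun t ht => ⟨ht, mem_univ _⟩
  choose D hD using horigin
  have hDle : ∀ j, D j ≤ ∑ j, |D j| := fun j => (le_abs_self _).trans <|
    Finset.single_le_sum (f := fun j => |D j|) (fun j _ => abs_nonneg _) (Finset.mem_univ j)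
  refine ⟨|C| + ∑ j, |D j|, by positivity, fun j t ht x => ⟨(hC j t ht x).trans ?_, ?_⟩⟩
  · have : C ≤ |C| + ∑ j, |D j| := (le_abs_self C).trans (le_add_of_nonneg_right (by positivity))
    gcongr
  · refine (abs_le_of_norm_gradient_le ((hp.contDiff j t ht).differentiable two_ne_zero)
      (hC j t ht) x).trans ?_
    have horig := (hD j t (Ico_subset_Icc_self ht)).trans (hDle j)
    rw [Real.norm_eq_abs] at horig
    rw [add_comm |C|]
    gcongr
    exact le_abs_self C

theorem IsAdjoint.exists_hasQuadraticJet (hp : S.IsAdjoint a m p) {τ : ℝ} (hτ : τ ∈ Ico 0 S.T) :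
    ∃ B, ∀ j, ∀ t ∈ Icc 0 τ, HasQuadraticJet B (p j t) := by
  obtain ⟨C, _, hC⟩ := hp.exists_growth
  obtain ⟨D, hD⟩ := hp.hessian_bound τ hτ
  refine ⟨max C D, fun j t ht => ?_⟩
  have ht' : t ∈ Ico 0 S.T := ⟨ht.1, ht.2.trans_lt hτ.2⟩
  refine ⟨hp.contDiff j t ht', fun i hi x => ?_⟩
  have hCmax : C ≤ max C D := le_max_left C D
  interval_cases i
  · rw [norm_iteratedFDeriv_zero, Real.norm_eq_abs]
    exact (hC j t ht' x).2.trans (by gcongr)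
  · rw [← norm_gradient_eq_norm_iteratedFDeriv_one, pow_one]
    exact (hC j t ht' x).1.trans (by gcongr)
  · rw [Nat.sub_self, pow_zero, mul_one]
    exact (hD j t ht x).trans (le_max_right C D)

/-- The linearization of the interaction term which enters the adjoint equation, that is
`(G_{φ_r}[m]ᵀ (Λ + Λᵀ))_j`. -/
noncomputable def adjointInteraction (S : CrowdModel d M) (m : Fin M → Pt d → ℝ) (j : Fin M)
    (x : Pt d) : ℝ :=
  (S.G m x ᵥ* (S.Λ + S.Λᵀ)) j

/-- The part `½|a^j|² + (G_{φ_r}[m]ᵀ (Λ + Λᵀ))_j` of the adjoint equation which does not involve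
`p`. -/
noncomputable def adjointSource (S : CrowdModel d M) (a : Fin M → ℝ → Pt d → Pt d)
    (m : Fin M → ℝ → Pt d → ℝ) (j : Fin M) (t : ℝ) (x : Pt d) : ℝ :=
  (1 / 2) * ‖a j t x‖ ^ 2 + S.adjointInteraction (fun k => m k t) j x

/-- `∂p_j/∂t` plus the generator belonging to the control `α`, applied to `p_j`; the second order
terms cancel. -/
noncomputable def adjointGap (S : CrowdModel d M) (a : Fin M → ℝ → Pt d → Pt d)
    (m p : Fin M → ℝ → Pt d → ℝ) (α : ℝ → Pt d → Pt d) (j : Fin M) (t : ℝ) (x : Pt d) : ℝ :=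
  inner ℝ (S.b t x (α t x)) (gradient (p j t) x) -
    (S.adjointSource a m j t x + inner ℝ (S.b t x (a j t x)) (gradient (p j t) x))

theorem adjointInteraction_eq_sum (m : Fin M → Pt d → ℝ) (j : Fin M) (x : Pt d) :
    S.adjointInteraction m j x = ∑ k, S.G m x k * (S.Λ k j + S.Λ j k) := by
  simp [adjointInteraction, Matrix.vecMul, dotProduct]

theorem Standing.exists_adjointInteraction_bound (hS : S.Standing) : ∃ C, 0 ≤ C ∧
    ∀ m : Fin M → Pt d → ℝ, (∀ j, IsDensity2 (m j)) → ∀ j x,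
      |S.adjointInteraction m j x| ≤ C := by
  obtain ⟨C, hC0, hC⟩ := hS.exists_G_bound
  refine ⟨∑ j, ∑ k, C * |S.Λ k j + S.Λ j k|, by positivity, fun m hm j x => ?_⟩
  rw [adjointInteraction_eq_sum]
  refine (Finset.abs_sum_le_sum_abs _ _).trans ?_
  refine le_trans ?_ (Finset.single_le_sum (f := fun j => ∑ k, C * |S.Λ k j + S.Λ j k|)
    (fun j _ => by positivity) (Finset.mem_univ j))
  refine Finset.sum_le_sum fun k _ => ?_
  rw [abs_mul]
  exact mul_le_mul_of_nonneg_right (hC m k (hm k) x) (abs_nonneg _)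

theorem IsState.measurable_adjointInteraction (hS : S.Standing) (hm : S.IsState a m) (j : Fin M) :
    Measurable fun z : ℝ × Pt d => S.adjointInteraction (fun k => m k z.1) j z.2 := by
  simp_rw [adjointInteraction_eq_sum]
  exact Finset.measurable_sum _ fun k _ => (hS.measurable_G k (hm.measurable k)).mul_const _

theorem IsState.measurable_adjointSource (hS : S.Standing) (hm : S.IsState a m) {j : Fin M}
    (ha : S.IsControl (a j)) : Measurable (uncurry (S.adjointSource a m j)) :=
  ((ha.1.norm.pow_const 2).const_mul _).add (hm.measurable_adjointInteraction hS j)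

theorem IsState.exists_abs_adjointSource_le (hS : S.Standing) (hm : S.IsState a m)
    (ha : ∀ j, S.IsControl (a j)) : ∃ C, 0 ≤ C ∧
    ∀ j, ∀ t ∈ Icc 0 S.T, ∀ x, |S.adjointSource a m j t x| ≤ C * (1 + ‖x‖) ^ 2 := by
  obtain ⟨K, _, hK⟩ := hS.exists_growth
  obtain ⟨D, hD0, hD⟩ := hS.exists_adjointInteraction_bound
  refine ⟨(1 / 2) * K ^ 2 + D, by positivity, fun j t ht x => ?_⟩
  have hcontrol : |(1 / 2) * ‖a j t x‖ ^ 2| ≤ (1 / 2) * K ^ 2 := by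
    rw [abs_of_nonneg (by positivity)]
    gcongr
    exact (hK t ht x _ ((ha j).mem_hull t x)).1
  exact ((abs_add_le _ _).trans (add_le_add hcontrol (hD _ (fun k => hm.density k t ht) j x))).trans
    (le_mul_of_one_le_right (by positivity) (one_le_pow₀ (by linarith [norm_nonneg x])))

theorem aestronglyMeasurable_inner_drift (hS : S.Standing) (hp : S.IsAdjoint a m p)
    {α : ℝ → Pt d → Pt d} (hα : S.IsControl α) (j : Fin M) :
    AEStronglyMeasurable (fun z : ℝ × Pt d => inner ℝ (S.b z.1 z.2 (α z.1 z.2))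
      (gradient (p j z.1) z.2)) (S.timeVol.prod volume) :=
  (hS.aestronglyMeasurable_drift hα).inner
    (aestronglyMeasurable_of_continuousOn_Ico (hp.gradient_continuous j))

theorem aestronglyMeasurable_adjointGap (hS : S.Standing) (ha : ∀ j, S.IsControl (a j))
    (hm : S.IsState a m) (hp : S.IsAdjoint a m p) {α : ℝ → Pt d → Pt d} (hα : S.IsControl α)
    (j : Fin M) :
    AEStronglyMeasurable (uncurry (S.adjointGap a m p α j)) (S.timeVol.prod volume) :=
  (aestronglyMeasurable_inner_drift hS hp hα j).sub
    ((hm.measurable_adjointSource hS (ha j)).aestronglyMeasurable.add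
      (aestronglyMeasurable_inner_drift hS hp (ha j) j))

theorem exists_abs_inner_drift_le (hS : S.Standing) (hp : S.IsAdjoint a m p) : ∃ C, 0 ≤ C ∧
    ∀ t ∈ Ico 0 S.T, ∀ x, ∀ α ∈ convexHull ℝ S.A, ∀ j,
      |inner ℝ (S.b t x α) (gradient (p j t) x)| ≤ C * (1 + ‖x‖) ^ 2 := by
  obtain ⟨K, hK0, hK⟩ := hS.exists_growth
  obtain ⟨C, hC0, hC⟩ := hp.exists_growth
  refine ⟨K * C, by positivity, fun t ht x α hα j => ?_⟩
  calc |inner ℝ (S.b t x α) (gradient (p j t) x)|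
      ≤ ‖S.b t x α‖ * ‖gradient (p j t) x‖ := abs_real_inner_le_norm _ _
    _ ≤ (K * (1 + ‖x‖)) * (C * (1 + ‖x‖)) := by
        gcongr
        exacts [(hK t (Ico_subset_Icc_self ht) x α hα).2.1, (hC j t ht x).1]
    _ = K * C * (1 + ‖x‖) ^ 2 := by ring

theorem exists_adjointGap_bound (hS : S.Standing) (ha : ∀ j, S.IsControl (a j))
    (hm : S.IsState a m) (hp : S.IsAdjoint a m p) : ∃ C, 0 ≤ C ∧
    ∀ α : ℝ → Pt d → Pt d, S.IsControl α → ∀ j, ∀ t ∈ Ico 0 S.T, ∀ x,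
      |S.adjointGap a m p α j t x| ≤ C * (1 + ‖x‖) ^ 2 := by
  obtain ⟨C, hC0, hC⟩ := exists_abs_inner_drift_le hS hp
  obtain ⟨D, hD0, hD⟩ := hm.exists_abs_adjointSource_le hS ha
  refine ⟨C + (D + C), by positivity, fun α hα j t ht x => ?_⟩
  rw [adjointGap, add_mul, add_mul]
  exact (abs_sub _ _).trans (add_le_add (hC t ht x _ (hα.mem_hull t x) j)
    ((abs_add_le _ _).trans (add_le_add (hD j t (Ico_subset_Icc_self ht) x)
      (hC t ht x _ ((ha j).mem_hull t x) j))))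

end StateAdjoint

end CrowdModel

/-! ### The generator -/

theorem abs_trace_mul_transpose_mul_le {d : ℕ} {B H : Matrix (Fin d) (Fin d) ℝ} {s h : ℝ}
    (hB : ∀ i k, |B i k| ≤ s) (hH : ∀ i k, |H i k| ≤ h) :
    |(B * Bᵀ * H).trace| ≤ d ^ 3 * (s ^ 2 * h) := by
  have hterm : ∀ i k l, |B i l * B k l * H k i| ≤ s ^ 2 * h := fun i k l => by
    have hs : 0 ≤ s := (abs_nonneg _).trans (hB i l)
    rw [abs_mul, abs_mul, sq]
    gcongr
    exacts [hB i l, hB k l, hH k i]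
  calc |(B * Bᵀ * H).trace| = |∑ i, ∑ k, ∑ l, B i l * B k l * H k i| := by
        simp only [Matrix.trace, Matrix.diag, Matrix.mul_apply, Matrix.transpose_apply,
          Finset.sum_mul]
    _ ≤ ∑ i, ∑ k, ∑ l, |B i l * B k l * H k i| :=
        (Finset.abs_sum_le_sum_abs _ _).trans <| Finset.sum_le_sum fun i _ =>
          (Finset.abs_sum_le_sum_abs _ _).trans <| Finset.sum_le_sum fun k _ =>
            Finset.abs_sum_le_sum_abs _ _
    _ ≤ ∑ _i : Fin d, ∑ _k : Fin d, ∑ _l : Fin d, s ^ 2 * h :=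
        Finset.sum_le_sum fun i _ => Finset.sum_le_sum fun k _ => Finset.sum_le_sum fun l _ =>
          hterm i k l
    _ = d ^ 3 * (s ^ 2 * h) := by
        simp only [Finset.sum_const, Finset.card_univ, Fintype.card_fin, nsmul_eq_mul]
        ring

theorem abs_hessian_sub_apply_le {d : ℕ} (f g : Pt d → ℝ) (x : Pt d) (i k : Fin d) :
    |(hessian f x - hessian g x) i k| ≤ ‖iteratedFDeriv ℝ 2 f x - iteratedFDeriv ℝ 2 g x‖ := by
  have h := (iteratedFDeriv ℝ 2 f x - iteratedFDeriv ℝ 2 g x).le_opNorm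
    ![EuclideanSpace.single i (1 : ℝ), EuclideanSpace.single k (1 : ℝ)]
  simpa [Fin.prod_univ_two, hessian] using h

namespace CrowdModel

open Function Filter Topology

section Generator

variable {d M : ℕ} {S : CrowdModel d M}

/-- The generator `b(t,x,α) · ∇f(x) + ½ tr(σσᵀ(t,x) ∇²f(x))` of the diffusion frozen at the control
value `α`. -/
noncomputable def generator (S : CrowdModel d M) (t : ℝ) (α : Pt d) (f : Pt d → ℝ) (x : Pt d) : ℝ :=
  inner ℝ (S.b t x α) (gradient f x) + S.diffusionTerm t f x

theorem generator_congr {f g : Pt d → ℝ} {x : Pt d} (h : f =ᶠ[𝓝 x] g) (t : ℝ) (α : Pt d) :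
    S.generator t α f x = S.generator t α g x := by
  simp only [generator, diffusionTerm, hessian, gradient, h.fderiv_eq,
    (h.iteratedFDeriv ℝ 2).self_of_nhds]

theorem diffusionTerm_sub (t : ℝ) (f g : Pt d → ℝ) (x : Pt d) :
    S.diffusionTerm t f x - S.diffusionTerm t g x =
      (1 / 2) * (S.σ t x * (S.σ t x)ᵀ * (hessian f x - hessian g x)).trace := by
  rw [diffusionTerm, diffusionTerm, Matrix.mul_sub, Matrix.trace_sub, mul_sub]

theorem Standing.exists_abs_generator_sub_le (hS : S.Standing) : ∃ K, 0 ≤ K ∧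
    ∀ t ∈ Icc 0 S.T, ∀ x, ∀ α ∈ convexHull ℝ S.A, ∀ f g : Pt d → ℝ,
      |S.generator t α f x - S.generator t α g x| ≤
        K * ((1 + ‖x‖) * ‖gradient f x - gradient g x‖ +
          (1 + ‖x‖) ^ 2 * ‖iteratedFDeriv ℝ 2 f x - iteratedFDeriv ℝ 2 g x‖) := by
  obtain ⟨K, hK0, hK⟩ := hS.exists_growth
  refine ⟨K + d ^ 3 * K ^ 2 / 2, by positivity, fun t ht x α hα f g => ?_⟩
  obtain ⟨-, hb, hσ, -⟩ := hK t ht x α hα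
  have hdrift : |inner ℝ (S.b t x α) (gradient f x - gradient g x)| ≤
      K * ((1 + ‖x‖) * ‖gradient f x - gradient g x‖) :=
    calc _ ≤ ‖S.b t x α‖ * ‖gradient f x - gradient g x‖ := abs_real_inner_le_norm _ _
      _ ≤ K * (1 + ‖x‖) * ‖gradient f x - gradient g x‖ := by gcongr
      _ = _ := mul_assoc _ _ _
  have hdiffusion := abs_trace_mul_transpose_mul_le hσ (abs_hessian_sub_apply_le f g x)
  have hsplit : S.generator t α f x - S.generator t α g x =
      inner ℝ (S.b t x α) (gradient f x - gradient g x) +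
        (1 / 2) * (S.σ t x * (S.σ t x)ᵀ * (hessian f x - hessian g x)).trace := by
    rw [← diffusionTerm_sub, inner_sub_right, generator, generator]
    ring
  rw [hsplit]
  refine (abs_add_le _ _).trans ?_
  rw [abs_mul, abs_of_pos (by norm_num : (0 : ℝ) < 1 / 2)]
  set G := (1 + ‖x‖) * ‖gradient f x - gradient g x‖
  set H := ‖iteratedFDeriv ℝ 2 f x - iteratedFDeriv ℝ 2 g x‖
  have hG : 0 ≤ d ^ 3 * K ^ 2 * G := by positivity
  have hH : 0 ≤ K * ((1 + ‖x‖) ^ 2 * H) := by positivity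
  nlinarith

theorem Standing.exists_abs_generator_le (hS : S.Standing) : ∃ K, 0 ≤ K ∧
    ∀ t ∈ Icc 0 S.T, ∀ x, ∀ α ∈ convexHull ℝ S.A, ∀ (B : ℝ) (f : Pt d → ℝ),
      HasQuadraticJet B f → |S.generator t α f x| ≤ K * B * (1 + ‖x‖) ^ 2 := by
  obtain ⟨K, hK0, hK⟩ := hS.exists_abs_generator_sub_le
  refine ⟨2 * K, by positivity, fun t ht x α hα B f hf => ?_⟩
  have hzero : S.generator t α (fun _ => (0 : ℝ)) x = 0 := by
    have : hessian (fun _ : Pt d => (0 : ℝ)) x = 0 := by ext; simp [hessian]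
    simp [generator, diffusionTerm, this, gradient_fun_const]
  have hgradient := hf.norm_iteratedFDeriv_le 1 one_le_two x
  have hhessian := hf.norm_iteratedFDeriv_le 2 le_rfl x
  rw [← norm_gradient_eq_norm_iteratedFDeriv_one] at hgradient
  have h := hK t ht x α hα f fun _ => 0
  rw [hzero, sub_zero, gradient_fun_const, sub_zero] at h
  simp only [iteratedFDeriv_fun_zero, Pi.zero_apply, sub_zero] at h
  refine h.trans ?_
  calc K * ((1 + ‖x‖) * ‖gradient f x‖ + (1 + ‖x‖) ^ 2 * ‖iteratedFDeriv ℝ 2 f x‖)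
      ≤ K * ((1 + ‖x‖) * (B * (1 + ‖x‖) ^ (2 - 1)) +
          (1 + ‖x‖) ^ 2 * (B * (1 + ‖x‖) ^ (2 - 2))) := by gcongr
    _ = 2 * K * B * (1 + ‖x‖) ^ 2 := by simp only [Nat.sub_self]; ring

theorem Standing.continuousOn_diffusionTerm (hS : S.Standing) {q : ℝ → Pt d → ℝ}
    {s : Set (ℝ × Pt d)} (hs : s ⊆ Icc 0 S.T ×ˢ univ)
    (hhessian : ContinuousOn (fun z : ℝ × Pt d => iteratedFDeriv ℝ 2 (q z.1) z.2) s) :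
    ContinuousOn (fun z : ℝ × Pt d => S.diffusionTerm z.1 (q z.1) z.2) s := by
  have hH : ContinuousOn (fun z : ℝ × Pt d => hessian (q z.1) z.2) s := by
    refine continuousOn_pi.2 fun i => continuousOn_pi.2 fun k => ?_
    exact (ContinuousMultilinearMap.apply ℝ (fun _ : Fin 2 => Pt d) ℝ
      ![EuclideanSpace.single i (1 : ℝ), EuclideanSpace.single k 1]).continuous.comp_continuousOn
        hhessian
  have htrace : Continuous fun P : Matrix (Fin d) (Fin d) ℝ × Matrix (Fin d) (Fin d) ℝ =>
      (1 / 2) * (P.1 * P.1ᵀ * P.2).trace :=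
    continuous_const.mul ((continuous_fst.matrix_mul
      continuous_fst.matrix_transpose).matrix_mul continuous_snd).matrix_trace
  exact htrace.comp_continuousOn (f := fun z : ℝ × Pt d => (S.σ z.1 z.2, hessian (q z.1) z.2))
    ((hS.σ_continuous.mono hs).prodMk hH)

theorem Standing.aestronglyMeasurable_generator (hS : S.Standing) {α : ℝ → Pt d → Pt d}
    (hα : S.IsControl α) {q : ℝ → Pt d → ℝ}
    (hgradient : ContinuousOn (fun z : ℝ × Pt d => gradient (q z.1) z.2) (Ico 0 S.T ×ˢ univ))
    (hhessian : ContinuousOn (fun z : ℝ × Pt d => iteratedFDeriv ℝ 2 (q z.1) z.2)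
      (Ico 0 S.T ×ˢ univ)) :
    AEStronglyMeasurable (fun z : ℝ × Pt d => S.generator z.1 (α z.1 z.2) (q z.1) z.2)
      (S.timeVol.prod volume) :=
  ((hS.aestronglyMeasurable_drift hα).inner
    (aestronglyMeasurable_of_continuousOn_Ico hgradient)).add
    (aestronglyMeasurable_of_continuousOn_Ico
      (hS.continuousOn_diffusionTerm (prod_mono_left Ico_subset_Icc_self) hhessian))

theorem Standing.aestronglyMeasurable_generator_of_contDiff (hS : S.Standing)
    {α : ℝ → Pt d → Pt d} (hα : S.IsControl α) {f : Pt d → ℝ} (hf : ContDiff ℝ 2 f) :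
    AEStronglyMeasurable (fun z : ℝ × Pt d => S.generator z.1 (α z.1 z.2) f z.2)
      (S.timeVol.prod volume) :=
  hS.aestronglyMeasurable_generator hα (q := fun _ => f)
    ((continuous_gradient_of_contDiff hf).comp continuous_snd).continuousOn
    ((hf.continuous_iteratedFDeriv le_rfl).comp continuous_snd).continuousOn

theorem Standing.aestronglyMeasurable_generator_slice (hS : S.Standing) {α : ℝ → Pt d → Pt d}
    (hα : S.IsControl α) {f : Pt d → ℝ} (hf : ContDiff ℝ 2 f) {t : ℝ} (ht : t ∈ Icc 0 S.T) :
    AEStronglyMeasurable fun x => S.generator t (α t x) f x := by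
  have hdiffusion : Continuous fun x => S.diffusionTerm t f x :=
    (hS.continuousOn_diffusionTerm (q := fun _ => f) subset_rfl
      ((hf.continuous_iteratedFDeriv le_rfl).comp continuous_snd).continuousOn).comp_continuous
      (f := fun x => (t, x)) (by fun_prop) fun x => ⟨ht, mem_univ x⟩
  exact ((hS.measurable_drift ht hα.1.of_uncurry_left (hα.mem_hull t)).aestronglyMeasurable.inner
    (continuous_gradient_of_contDiff hf).aestronglyMeasurable).add
      hdiffusion.aestronglyMeasurable

end Generator

end CrowdModel

/-! ### Pairing with a state -/

theorem exists_forall_norm_sub_le_on_ball {E F : Type*} [NormedAddCommGroup E]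
    [ProperSpace E] [NormedAddCommGroup F] {f : ℝ → E → F} {b c : ℝ}
    (hf : ContinuousOn (Function.uncurry f) (Icc b c ×ˢ univ)) (R : ℝ) {ε : ℝ} (hε : 0 < ε) :
    ∃ δ > 0, ∀ t ∈ Icc b c, ∀ u ∈ Icc b c, |t - u| < δ → ∀ x, ‖x‖ ≤ R → ‖f t x - f u x‖ ≤ ε := by
  have hcompact : IsCompact (Icc b c ×ˢ Metric.closedBall (0 : E) R) :=
    isCompact_Icc.prod (isCompact_closedBall 0 R)
  obtain ⟨δ, hδ, h⟩ := Metric.uniformContinuousOn_iff.1 (hcompact.uniformContinuousOn_of_continuous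
    (hf.mono (prod_mono_right (subset_univ _)))) ε hε
  refine ⟨δ, hδ, fun t ht u hu htu x hx => ?_⟩
  have hx' : x ∈ Metric.closedBall (0 : E) R := mem_closedBall_zero_iff.2 hx
  rw [← dist_eq_norm]
  exact (h (t, x) ⟨ht, hx'⟩ (u, x) ⟨hu, hx'⟩ (by simpa [Prod.dist_eq, Real.dist_eq, hδ])).le

section WeightedDensity

open Filter Topology

variable {d : ℕ} {u : Pt d → ℝ} {C : ℝ}

theorem IsDensity2.abs_integral_mul_le {φ : Pt d → ℝ} (hu : IsDensity2 u)
    (h : ∀ x, |φ x| ≤ C * (1 + ‖x‖) ^ 2) :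
    |∫ x, φ x * u x| ≤ C * ∫ x, (1 + ‖x‖) ^ 2 * u x := by
  rw [← integral_const_mul, ← Real.norm_eq_abs]
  refine norm_integral_le_of_norm_le (hu.integrable_weight.const_mul C)
    (Eventually.of_forall fun x => ?_)
  rw [norm_mul, Real.norm_of_nonneg (hu.nonneg x), ← mul_assoc]
  exact mul_le_mul_of_nonneg_right (h x) (hu.nonneg x)

theorem IsDensity2.tendsto_integral_mul {φ : ℕ → Pt d → ℝ} {ψ : Pt d → ℝ} (hu : IsDensity2 u)
    (hφ : ∀ n, AEStronglyMeasurable (φ n)) (h : ∀ n x, |φ n x| ≤ C * (1 + ‖x‖) ^ 2)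
    (hlim : ∀ x, Tendsto (fun n => φ n x) atTop (𝓝 (ψ x))) :
    Tendsto (fun n => ∫ x, φ n x * u x) atTop (𝓝 (∫ x, ψ x * u x)) := by
  refine tendsto_integral_of_dominated_convergence (fun x => C * ((1 + ‖x‖) ^ 2 * u x))
    (fun n => (hφ n).mul hu.measurable.aestronglyMeasurable) (hu.integrable_weight.const_mul C)
    (fun n => Eventually.of_forall fun x => ?_)
    (Eventually.of_forall fun x => (hlim x).mul_const _)
  rw [norm_mul, Real.norm_of_nonneg (hu.nonneg x), ← mul_assoc]
  exact mul_le_mul_of_nonneg_right (h n x) (hu.nonneg x)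

/-- The part of the second moment beyond the level `n`, as a weight. -/
noncomputable def momentTail (n : ℕ) (x : Pt d) : ℝ := max (‖x‖ ^ 2 - n) 0

theorem continuous_momentTail (n : ℕ) : Continuous (momentTail n : Pt d → ℝ) := by
  unfold momentTail
  fun_prop

theorem momentTail_nonneg (n : ℕ) (x : Pt d) : 0 ≤ momentTail n x := le_max_right _ _

theorem abs_momentTail_le (n : ℕ) (x : Pt d) : |momentTail n x| ≤ 1 * (1 + ‖x‖) ^ 2 := by
  rw [abs_of_nonneg (momentTail_nonneg n x), one_mul]
  refine max_le ?_ (by positivity)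
  nlinarith [norm_nonneg x, n.cast_nonneg (α := ℝ)]

theorem IsDensity2.integrable_momentTail_mul (hu : IsDensity2 u) (n : ℕ) :
    Integrable fun x => momentTail n x * u x :=
  hu.integrable_mul (continuous_momentTail n).aestronglyMeasurable (abs_momentTail_le n)

theorem IsDensity2.antitone_integral_momentTail_mul (hu : IsDensity2 u) :
    Antitone fun n : ℕ => ∫ x, momentTail n x * u x := fun n k hnk =>
  integral_mono (hu.integrable_momentTail_mul k) (hu.integrable_momentTail_mul n) fun x =>
    mul_le_mul_of_nonneg_right (max_le_max_right _ (by gcongr)) (hu.nonneg x)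

theorem IsDensity2.tendsto_integral_momentTail_mul (hu : IsDensity2 u) :
    Tendsto (fun n : ℕ => ∫ x, momentTail n x * u x) atTop (𝓝 0) := by
  have h := hu.tendsto_integral_mul (φ := momentTail) (ψ := 0)
    (fun n => (continuous_momentTail n).aestronglyMeasurable) abs_momentTail_le fun x => ?_
  · simpa using h
  · refine tendsto_atTop_of_eventually_const (i₀ := ⌈‖x‖ ^ 2⌉₊) fun n hn => ?_
    simpa [momentTail] using Nat.ceil_le.1 hn

end WeightedDensity

namespace CrowdModel

open Function Filter Topology

section StateIntegral

variable {d M : ℕ} {S : CrowdModel d M} {a : Fin M → ℝ → Pt d → Pt d} {m : Fin M → ℝ → Pt d → ℝ}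

theorem IsState.exists_abs_integral_mul_le (hm : S.IsState a m) (j : Fin M) {C : ℝ} (hC : 0 ≤ C) :
    ∃ D, ∀ t ∈ Icc 0 S.T, ∀ φ : Pt d → ℝ, (∀ x, |φ x| ≤ C * (1 + ‖x‖) ^ 2) →
      |∫ x, φ x * m j t x| ≤ D := by
  obtain ⟨D, hD⟩ := hm.exists_integral_weight_le j
  refine ⟨C * D, fun t ht φ hφ => ((hm.density j t ht).abs_integral_mul_le hφ).trans ?_⟩
  gcongr
  exact hD t ht

theorem aestronglyMeasurable_restrict_Ioc {β : Type*} [TopologicalSpace β] {f : ℝ × Pt d → β}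
    (hf : AEStronglyMeasurable f (S.timeVol.prod volume)) {τ : ℝ} (hτ : τ ≤ S.T) :
    AEStronglyMeasurable f ((volume.restrict (Ioc 0 τ)).prod volume) := by
  rw [← restrict_Ioo_eq_restrict_Ioc]
  exact hf.mono_measure
    (Measure.prod_mono (Measure.restrict_mono (Ioo_subset_Ioo_right hτ) le_rfl) le_rfl)

theorem IsState.intervalIntegrable_integral_mul (hm : S.IsState a m) (j : Fin M) {τ C : ℝ}
    (hτ : τ ∈ Icc 0 S.T) {φ : ℝ → Pt d → ℝ}
    (hφ : AEStronglyMeasurable (uncurry φ) (S.timeVol.prod volume)) (hC : 0 ≤ C)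
    (h : ∀ t ∈ Icc 0 τ, ∀ x, |φ t x| ≤ C * (1 + ‖x‖) ^ 2) :
    IntervalIntegrable (fun t => ∫ x, φ t x * m j t x) volume 0 τ := by
  obtain ⟨D, hD⟩ := hm.exists_abs_integral_mul_le j hC
  have hmeas : AEStronglyMeasurable (fun t => ∫ x, φ t x * m j t x) (volume.restrict (Ioc 0 τ)) :=
    (aestronglyMeasurable_restrict_Ioc (hφ.mul (hm.measurable j).aestronglyMeasurable)
      hτ.2).integral_prod_right'
  rw [intervalIntegrable_iff_integrableOn_Ioc_of_le hτ.1]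
  refine IntegrableOn.of_bound measure_Ioc_lt_top hmeas D ?_
  filter_upwards [ae_restrict_mem measurableSet_Ioc] with t ht
  have ht' := Ioc_subset_Icc_self ht
  exact hD t ⟨ht'.1, ht'.2.trans hτ.2⟩ _ (h t ht')

theorem IsState.tendsto_intervalIntegral_integral_mul (hm : S.IsState a m) (j : Fin M) {τ C : ℝ}
    (hτ : τ ∈ Icc 0 S.T) {φ : ℕ → ℝ → Pt d → ℝ} {ψ : ℝ → Pt d → ℝ}
    (hφ : ∀ n, AEStronglyMeasurable (uncurry (φ n)) (S.timeVol.prod volume)) (hC : 0 ≤ C)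
    (h : ∀ n, ∀ t ∈ Icc 0 τ, ∀ x, |φ n t x| ≤ C * (1 + ‖x‖) ^ 2)
    (hlim : ∀ t x, Tendsto (fun n => φ n t x) atTop (𝓝 (ψ t x))) :
    Tendsto (fun n => ∫ t in 0..τ, ∫ x, φ n t x * m j t x) atTop
      (𝓝 (∫ t in 0..τ, ∫ x, ψ t x * m j t x)) := by
  obtain ⟨D, hD⟩ := hm.exists_abs_integral_mul_le j hC
  have hmem : ∀ t ∈ uIoc 0 τ, t ∈ Icc 0 τ := fun t ht =>
    Ioc_subset_Icc_self (by rwa [uIoc_of_le hτ.1] at ht)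
  have hsection : ∀ᵐ t, t ∈ uIoc 0 τ → ∀ n, AEStronglyMeasurable (φ n t) := by
    rw [← ae_restrict_iff' measurableSet_uIoc, ae_all_iff, uIoc_of_le hτ.1]
    exact fun n => (aestronglyMeasurable_restrict_Ioc (hφ n) hτ.2).prodMk_left
  refine intervalIntegral.tendsto_integral_filter_of_dominated_convergence (fun _ => D)
    (Eventually.of_forall fun n => ?_)
    (Eventually.of_forall fun n => Eventually.of_forall fun t ht => ?_)
    intervalIntegrable_const ?_
  · rw [uIoc_of_le hτ.1]
    exact (hm.intervalIntegrable_integral_mul j hτ (hφ n) hC (h n)).aestronglyMeasurable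
  · exact hD t ⟨(hmem t ht).1, (hmem t ht).2.trans hτ.2⟩ _ (h n t (hmem t ht))
  · filter_upwards [hsection] with t hmeas ht
    exact (hm.density j t ⟨(hmem t ht).1, (hmem t ht).2.trans hτ.2⟩).tendsto_integral_mul
      (hmeas ht) (fun n => h n t (hmem t ht)) (hlim t)

/-! ### Uniform integrability of the second moments -/

theorem IsState.continuousOn_integral_mul_of_bounded (hm : S.IsState a m) (j : Fin M)
    {g : Pt d → ℝ} {C : ℝ} (hg : Continuous g) (hC : ∀ x, |g x| ≤ C) :
    ContinuousOn (fun t => ∫ x, g x * m j t x) (Icc 0 S.T) :=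
  hm.weak_continuous j (BoundedContinuousFunction.ofNormedAddCommGroup g hg C hC)

theorem IsState.continuousOn_integral_momentTail_mul (hm : S.IsState a m) (j : Fin M) (n : ℕ) :
    ContinuousOn (fun t => ∫ x, momentTail n x * m j t x) (Icc 0 S.T) := by
  have hmin : ContinuousOn (fun t => ∫ x, min (‖x‖ ^ 2) (n : ℝ) * m j t x) (Icc 0 S.T) :=
    hm.continuousOn_integral_mul_of_bounded j (by fun_prop) (C := n) fun x => by
      rw [abs_of_nonneg (le_min (by positivity) (by positivity))]
      exact min_le_right _ _
  refine ((hm.moment_continuous j).sub hmin).congr fun t ht => ?_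
  have hd := hm.density j t ht
  have hmin_eq : ∀ x, min (‖x‖ ^ 2) (n : ℝ) * m j t x =
      ‖x‖ ^ 2 * m j t x - momentTail n x * m j t x := fun x => by
    rw [← sub_mul, momentTail]
    rcases le_total (‖x‖ ^ 2) (n : ℝ) with hx | hx <;> simp [hx]
  simp only [hmin_eq, Pi.sub_apply]
  rw [integral_sub hd.secondMoment (hd.integrable_momentTail_mul n), sub_sub_cancel]

theorem IsState.exists_integral_momentTail_le (hm : S.IsState a m) (j : Fin M) {ε : ℝ}
    (hε : 0 < ε) : ∃ N : ℕ, ∀ t ∈ Icc 0 S.T, ∫ x, momentTail N x * m j t x ≤ ε := by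
  obtain ⟨N, hN⟩ := (Metric.tendstoUniformlyOn_iff.1
    (Antitone.tendstoUniformlyOn_of_forall_tendsto isCompact_Icc
      (hm.continuousOn_integral_momentTail_mul j)
      (fun t ht => (hm.density j t ht).antitone_integral_momentTail_mul) continuousOn_const
      fun t ht => (hm.density j t ht).tendsto_integral_momentTail_mul) ε hε).exists
  refine ⟨N, fun t ht => ?_⟩
  have := hN t ht
  rw [dist_zero_left, Real.norm_eq_abs] at this
  exact ((le_abs_self _).trans_lt this).le

theorem IsState.exists_forall_abs_integral_mul_le (hm : S.IsState a m) (j : Fin M) {C ε : ℝ}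
    (hC : 0 ≤ C) (hε : 0 < ε) :
    ∃ R, ∃ η > 0, ∀ t ∈ Icc 0 S.T, ∀ h : Pt d → ℝ, (∀ x, |h x| ≤ C * (1 + ‖x‖) ^ 2) →
      (∀ x, ‖x‖ ≤ R → |h x| ≤ η) → |∫ x, h x * m j t x| ≤ ε := by
  obtain ⟨N, hN⟩ := hm.exists_integral_momentTail_le j (ε := ε / (8 * (C + 1))) (by positivity)
  refine ⟨2 * N + 1, ε / 2, by positivity, fun t ht h hbound hball => ?_⟩
  have hd := hm.density j t ht
  have hpointwise : ∀ x, |h x| ≤ ε / 2 + 4 * C * momentTail N x := fun x => by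
    rcases le_or_gt ‖x‖ (2 * N + 1) with hx | hx
    · exact (hball x hx).trans (le_add_of_nonneg_right
        (mul_nonneg (by positivity) (momentTail_nonneg N x)))
    · have : (0 : ℝ) ≤ N := N.cast_nonneg
      have hfar : (1 + ‖x‖) ^ 2 ≤ 4 * (‖x‖ ^ 2 - N) := by nlinarith [sq_nonneg (‖x‖ - 1)]
      calc |h x| ≤ C * (1 + ‖x‖) ^ 2 := hbound x
        _ ≤ C * (4 * momentTail N x) := by
            gcongr
            exact hfar.trans (by gcongr; exact le_max_left _ _)
        _ ≤ ε / 2 + 4 * C * momentTail N x := by linarith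
  calc |∫ x, h x * m j t x|
      ≤ ∫ x, (ε / 2 * m j t x + 4 * C * (momentTail N x * m j t x)) := by
        rw [← Real.norm_eq_abs]
        refine norm_integral_le_of_norm_le ((hd.integrable.const_mul _).add
          ((hd.integrable_momentTail_mul N).const_mul _)) (Eventually.of_forall fun x => ?_)
        rw [norm_mul, Real.norm_of_nonneg (hd.nonneg x), ← mul_assoc, ← add_mul]
        exact mul_le_mul_of_nonneg_right (hpointwise x) (hd.nonneg x)
    _ = ε / 2 + 4 * C * ∫ x, momentTail N x * m j t x := by
        rw [integral_add (hd.integrable.const_mul _)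
          ((hd.integrable_momentTail_mul N).const_mul _), integral_const_mul, integral_const_mul,
          hd.integral_eq_one, mul_one]
    _ ≤ ε / 2 + 4 * C * (ε / (8 * (C + 1))) := by
        gcongr
        exact hN t ht
    _ ≤ ε := by
        have : 4 * C * (ε / (8 * (C + 1))) = ε / 2 * (C / (C + 1)) := by field_simp; ring
        have : C / (C + 1) ≤ 1 := (div_le_one (by positivity)).2 (by linarith)
        nlinarith

theorem IsState.continuousOn_integral_mul_of_continuous (hm : S.IsState a m) (j : Fin M)
    {g : Pt d → ℝ} {C : ℝ} (hg : Continuous g) (hC : ∀ x, |g x| ≤ C * (1 + ‖x‖) ^ 2) :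
    ContinuousOn (fun t => ∫ x, g x * m j t x) (Icc 0 S.T) := by
  have hC0 : 0 ≤ C := by simpa using (abs_nonneg _).trans (hC 0)
  let clamp (n : ℕ) (x : Pt d) : ℝ := max (-n) (min (g x) n)
  have hclamp_cont : ∀ n, Continuous (clamp n) := fun n => by fun_prop
  have hclamp_le : ∀ n x, |clamp n x| ≤ n := fun n x => by
    have : (0 : ℝ) ≤ n := n.cast_nonneg
    exact abs_le.2 ⟨le_max_left _ _, max_le (by linarith) (min_le_right _ _)⟩
  have hclamp_eq : ∀ (n : ℕ) x, |g x| ≤ n → clamp n x = g x := fun n x hx => by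
    simp only [clamp, min_eq_left (abs_le.1 hx).2, max_eq_right (abs_le.1 hx).1]
  have hsub_le : ∀ n x, |g x - clamp n x| ≤ 2 * C * (1 + ‖x‖) ^ 2 := fun n x => by
    rcases le_or_gt |g x| n with hx | hx
    · rw [hclamp_eq n x hx, sub_self, abs_zero]
      positivity
    · linarith [abs_sub (g x) (clamp n x), hclamp_le n x, hC x]
  refine TendstoUniformlyOn.continuousOn (p := atTop) (Metric.tendstoUniformlyOn_iff.2
    fun ε hε => ?_) (Frequently.of_forall fun n =>
      hm.continuousOn_integral_mul_of_bounded j (hclamp_cont n) (hclamp_le n))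
  obtain ⟨R, η, hη, hR⟩ := hm.exists_forall_abs_integral_mul_le j (C := 2 * C) (by positivity)
    (half_pos hε)
  filter_upwards [eventually_ge_atTop ⌈C * (1 + R) ^ 2⌉₊] with n hn t ht
  have hd := hm.density j t ht
  have hclamp_int : Integrable fun x => clamp n x * m j t x :=
    hd.integrable.bdd_mul (hclamp_cont n).aestronglyMeasurable (Eventually.of_forall (hclamp_le n))
  rw [Real.dist_eq, ← integral_sub (hd.integrable_mul hg.aestronglyMeasurable hC) hclamp_int]
  simp only [← sub_mul]
  refine (hR t ht (fun x => g x - clamp n x) (hsub_le n) fun x hx => ?_).trans_lt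
    (half_lt_self hε)
  rw [hclamp_eq n x, sub_self, abs_zero]
  · exact hη.le
  · exact (hC x).trans (le_trans (by gcongr) (Nat.ceil_le.1 hn))

theorem IsState.continuousOn_integral_mul (hm : S.IsState a m) (j : Fin M)
    {q : ℝ → Pt d → ℝ} {C : ℝ} (hq : ContinuousOn (uncurry q) (Icc 0 S.T ×ˢ univ))
    (hC : ∀ t ∈ Icc 0 S.T, ∀ x, |q t x| ≤ C * (1 + ‖x‖) ^ 2) :
    ContinuousOn (fun t => ∫ x, q t x * m j t x) (Icc 0 S.T) := by
  intro s hs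
  have hC0 : 0 ≤ C := by simpa using (abs_nonneg _).trans (hC s hs 0)
  have hslice : ∀ t ∈ Icc 0 S.T, Continuous (q t) := fun t ht =>
    hq.comp_continuous (f := fun x => (t, x)) (by fun_prop) fun x => ⟨ht, mem_univ x⟩
  have hfixed := hm.continuousOn_integral_mul_of_continuous j (hslice s hs) (hC s hs) s hs
  rw [Metric.continuousWithinAt_iff] at hfixed ⊢
  intro ε hε
  obtain ⟨R, η, hη, hR⟩ := hm.exists_forall_abs_integral_mul_le j (C := 2 * C) (by positivity)
    (half_pos hε)
  obtain ⟨δ₁, hδ₁, hmodulus⟩ := exists_forall_norm_sub_le_on_ball hq R hη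
  obtain ⟨δ₂, hδ₂, hclose⟩ := hfixed (ε / 2) (half_pos hε)
  refine ⟨min δ₁ δ₂, lt_min hδ₁ hδ₂, fun t ht hts => ?_⟩
  have hint : ∀ r ∈ Icc 0 S.T, Integrable fun x => q r x * m j t x := fun r hr =>
    (hm.density j t ht).integrable_mul (hslice r hr).aestronglyMeasurable (hC r hr)
  have hmoving : |(∫ x, q t x * m j t x) - ∫ x, q s x * m j t x| ≤ ε / 2 := by
    rw [← integral_sub (hint t ht) (hint s hs)]
    simp only [← sub_mul]
    refine hR t ht (fun x => q t x - q s x) (fun x => ?_) fun x hx =>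
      hmodulus t ht s hs (hts.trans_le (min_le_left _ _)) x hx
    linarith [abs_sub (q t x) (q s x), hC t ht x, hC s hs x]
  calc dist (∫ x, q t x * m j t x) (∫ x, q s x * m j s x)
      ≤ dist (∫ x, q t x * m j t x) (∫ x, q s x * m j t x) +
        dist (∫ x, q s x * m j t x) (∫ x, q s x * m j s x) := dist_triangle _ _ _
    _ < ε / 2 + ε / 2 :=
        add_lt_add_of_le_of_lt hmoving (hclose ht (hts.trans_le (min_le_right _ _)))
    _ = ε := add_halves ε

end StateIntegral

/-! ### Duality between states and the adjoint equation -/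

section Duality

variable {d M : ℕ} {S : CrowdModel d M} {a a' : Fin M → ℝ → Pt d → Pt d}
  {m m' p : Fin M → ℝ → Pt d → ℝ}

theorem IsState.integral_mul_sub_integral_mul_zero (hS : S.Standing) (hm : S.IsState a m)
    {j : Fin M} (ha : S.IsControl (a j)) {B : ℝ} {f : Pt d → ℝ} (hf : HasQuadraticJet B f)
    {t : ℝ} (ht : t ∈ Icc 0 S.T) :
    (∫ x, f x * m j t x) - (∫ x, f x * m j 0 x) =
      ∫ u in 0..t, ∫ x, S.generator u (a j u x) f x * m j u x := by
  obtain ⟨C, hC⟩ := exists_norm_iteratedFDeriv_cutoff_le (Pt d) 2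
  obtain ⟨K, hK0, hK⟩ := hS.exists_abs_generator_le
  have hjet (n : ℕ) : HasQuadraticJet (4 * C * B) fun x => cutoff n x * f x :=
    hf.mul (contDiff_cutoff n (k := 2)) (hC n)
  have heq (x : Pt d) : ∀ᶠ n in atTop, (fun y => cutoff n y * f y) =ᶠ[𝓝 x] f := by
    filter_upwards [eventually_cutoff_eventuallyEq_one x] with n hn
    filter_upwards [hn] with y hy
    rw [hy, Pi.one_apply, one_mul]
  have hB0 : 0 ≤ K * (4 * C * B) :=
    mul_nonneg hK0 (by simpa using (abs_nonneg _).trans ((hjet 0).abs_le 0))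
  have hslice {s : ℝ} (hs : s ∈ Icc 0 S.T) :
      Tendsto (fun n => ∫ x, cutoff n x * f x * m j s x) atTop (𝓝 (∫ x, f x * m j s x)) :=
    (hm.density j s hs).tendsto_integral_mul
      (fun n => (hjet n).contDiff.continuous.aestronglyMeasurable) (fun n => (hjet n).abs_le)
      fun x => tendsto_const_nhds.congr' ((heq x).mono fun n hn => hn.self_of_nhds.symm)
  refine tendsto_nhds_unique ((hslice ht).sub (hslice ⟨le_rfl, ht.1.trans ht.2⟩))
    ((hm.tendsto_intervalIntegral_integral_mul j ht
      (φ := fun n u x => S.generator u (a j u x) (fun y => cutoff n y * f y) x)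
      (fun n => hS.aestronglyMeasurable_generator_of_contDiff ha (hjet n).contDiff) hB0
      (fun n u hu x => hK u ⟨hu.1, hu.2.trans ht.2⟩ x _ (ha.mem_hull u x) _ _ (hjet n))
      fun u x => tendsto_const_nhds.congr' ((heq x).mono fun n hn =>
        (generator_congr hn u _).symm)).congr fun n => ?_)
  exact (hm.equation j _ (isCb2_of_hasCompactSupport (hjet n).contDiff
    ((hasCompactSupport_cutoff n).mul_right)) t ht).symm

theorem IsState.intervalIntegrable_generator (hS : S.Standing) (hm : S.IsState a m)
    {j : Fin M} (ha : S.IsControl (a j)) {B τ : ℝ} {q : ℝ → Pt d → ℝ} (hτ : τ ∈ Icc 0 S.T)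
    (hq : AEStronglyMeasurable (fun z : ℝ × Pt d => S.generator z.1 (a j z.1 z.2) (q z.1) z.2)
      (S.timeVol.prod volume))
    (hjet : ∀ t ∈ Icc 0 τ, HasQuadraticJet B (q t)) :
    IntervalIntegrable (fun u => ∫ x, S.generator u (a j u x) (q u) x * m j u x) volume 0 τ := by
  obtain ⟨K, hK0, hK⟩ := hS.exists_abs_generator_le
  have hB : 0 ≤ B := by simpa using (abs_nonneg _).trans ((hjet 0 ⟨le_rfl, hτ.1⟩).abs_le 0)
  exact hm.intervalIntegrable_integral_mul j hτ hq (by positivity)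
    fun u hu x => hK u ⟨hu.1, hu.2.trans hτ.2⟩ x _ (ha.mem_hull u x) _ _ (hjet u hu)

theorem IsState.integral_mul_sub_integral_mul (hS : S.Standing) (hm : S.IsState a m)
    {j : Fin M} (ha : S.IsControl (a j)) {B : ℝ} {f : Pt d → ℝ} (hf : HasQuadraticJet B f)
    {r s : ℝ} (hr : r ∈ Icc 0 S.T) (hs : s ∈ Icc 0 S.T) :
    (∫ x, f x * m j s x) - (∫ x, f x * m j r x) =
      ∫ u in r..s, ∫ x, S.generator u (a j u x) f x * m j u x := by
  have hint {t : ℝ} (ht : t ∈ Icc 0 S.T) :=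
    hm.intervalIntegrable_generator hS ha ht (q := fun _ => f)
      (hS.aestronglyMeasurable_generator_of_contDiff ha hf.contDiff) fun _ _ => hf
  rw [← intervalIntegral.integral_interval_sub_left (hint hs) (hint hr),
    ← hm.integral_mul_sub_integral_mul_zero hS ha hf hs,
    ← hm.integral_mul_sub_integral_mul_zero hS ha hf hr]
  ring

theorem IsState.integrable_generator_mul (hS : S.Standing) (hm : S.IsState a m)
    {j : Fin M} (ha : S.IsControl (a j)) {B t : ℝ} {f : Pt d → ℝ} (hf : HasQuadraticJet B f)
    (ht : t ∈ Icc 0 S.T) : Integrable fun x => S.generator t (a j t x) f x * m j t x := by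
  obtain ⟨K, -, hK⟩ := hS.exists_abs_generator_le
  exact (hm.density j t ht).integrable_mul
    (hS.aestronglyMeasurable_generator_slice ha hf.contDiff ht)
    fun x => hK t ht x _ (ha.mem_hull t x) _ _ hf

theorem IsAdjoint.exists_modulus_generator (hS : S.Standing) (hp : S.IsAdjoint a m p)
    (j : Fin M) {τ : ℝ} (hτ : τ ∈ Ico 0 S.T) (R : ℝ) {ε : ℝ} (hε : 0 < ε) :
    ∃ δ > 0, ∀ t ∈ Icc 0 τ, ∀ u ∈ Icc 0 τ, |t - u| < δ → ∀ x, ‖x‖ ≤ R →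
      ∀ α ∈ convexHull ℝ S.A, |S.generator u α (p j t) x - S.generator u α (p j u) x| ≤ ε := by
  obtain ⟨K, hK0, hK⟩ := hS.exists_abs_generator_sub_le
  have hsub : Icc 0 τ ×ˢ (univ : Set (Pt d)) ⊆ Ico 0 S.T ×ˢ univ :=
    prod_mono_left (Icc_subset_Ico_right hτ.2)
  set κ := K * ((1 + |R|) + (1 + |R|) ^ 2) + 1
  have hκ : 0 < κ := by positivity
  obtain ⟨δ₁, hδ₁, hgradient⟩ := exists_forall_norm_sub_le_on_ball
    (f := fun t => gradient (p j t)) ((hp.gradient_continuous j).mono hsub) R (div_pos hε hκ)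
  obtain ⟨δ₂, hδ₂, hhessian⟩ := exists_forall_norm_sub_le_on_ball
    (f := fun t => iteratedFDeriv ℝ 2 (p j t)) ((hp.hessian_continuous j).mono hsub) R
    (div_pos hε hκ)
  refine ⟨min δ₁ δ₂, lt_min hδ₁ hδ₂, fun t ht u hu htu x hx α hα => ?_⟩
  have hxR : ‖x‖ ≤ |R| := hx.trans (le_abs_self R)
  calc |S.generator u α (p j t) x - S.generator u α (p j u) x|
      ≤ K * ((1 + |R|) * (ε / κ) + (1 + |R|) ^ 2 * (ε / κ)) := by
        refine (hK u ⟨hu.1, hu.2.trans hτ.2.le⟩ x α hα _ _).trans ?_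
        gcongr
        · exact hgradient t ht u hu (htu.trans_le (min_le_left _ _)) x hx
        · exact hhessian t ht u hu (htu.trans_le (min_le_right _ _)) x hx
    _ = (κ - 1) * (ε / κ) := by ring
    _ ≤ κ * (ε / κ) := by gcongr; linarith
    _ = ε := mul_div_cancel₀ ε hκ.ne'

theorem exists_modulus_integral_generator (hS : S.Standing) (hp : S.IsAdjoint a m p)
    (hm' : S.IsState a' m') {j : Fin M} (ha' : S.IsControl (a' j)) {τ : ℝ} (hτ : τ ∈ Ico 0 S.T)
    {ε : ℝ} (hε : 0 < ε) :
    ∃ δ > 0, ∀ t ∈ Icc 0 τ, ∀ u ∈ Icc 0 τ, |t - u| < δ →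
      |(∫ x, S.generator u (a' j u x) (p j t) x * m' j u x) -
        ∫ x, S.generator u (a' j u x) (p j u) x * m' j u x| ≤ ε := by
  obtain ⟨B, hB⟩ := hp.exists_hasQuadraticJet hτ
  have hB0 : 0 ≤ B := by simpa using (abs_nonneg _).trans ((hB j 0 ⟨le_rfl, hτ.1⟩).abs_le 0)
  obtain ⟨K, hK0, hK⟩ := hS.exists_abs_generator_le
  obtain ⟨R, η, hη, hR⟩ := hm'.exists_forall_abs_integral_mul_le j (C := 2 * (K * B))
    (by positivity) hε
  obtain ⟨δ, hδ, hmodulus⟩ := hp.exists_modulus_generator hS j hτ R hη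
  refine ⟨δ, hδ, fun t ht u hu htu => ?_⟩
  have huT : u ∈ Icc 0 S.T := ⟨hu.1, hu.2.trans hτ.2.le⟩
  rw [← integral_sub (hm'.integrable_generator_mul hS ha' (hB j t ht) huT)
    (hm'.integrable_generator_mul hS ha' (hB j u hu) huT)]
  simp only [← sub_mul]
  refine hR u huT (fun x => S.generator u (a' j u x) (p j t) x -
    S.generator u (a' j u x) (p j u) x) (fun x => ?_)
    fun x hx => hmodulus t ht u hu htu x hx _ (ha'.mem_hull u x)
  have hbound {s : ℝ} (hs : s ∈ Icc 0 τ) := hK u huT x _ (ha'.mem_hull u x) B _ (hB j s hs)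
  exact (abs_sub _ _).trans ((add_le_add (hbound ht) (hbound hu)).trans_eq (by ring))

theorem adjointBracket_eq (j : Fin M) (t : ℝ) (x : Pt d) :
    S.adjointBracket a m p j t x =
      S.adjointSource a m j t x + S.generator t (a j t x) (p j t) x :=
  add_assoc _ _ _

theorem adjointGap_eq (α : ℝ → Pt d → Pt d) (j : Fin M) (t : ℝ) (x : Pt d) :
    S.adjointGap a m p α j t x =
      -S.adjointBracket a m p j t x + S.generator t (α t x) (p j t) x := by
  rw [adjointBracket_eq, adjointGap, generator, generator]
  ring

theorem aestronglyMeasurable_adjointBracket (hS : S.Standing) (hm : S.IsState a m)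
    (hp : S.IsAdjoint a m p) {j : Fin M} (ha : S.IsControl (a j)) :
    AEStronglyMeasurable (uncurry (S.adjointBracket a m p j)) (S.timeVol.prod volume) :=
  ((hm.measurable_adjointSource hS ha).aestronglyMeasurable.add
    (hS.aestronglyMeasurable_generator ha (hp.gradient_continuous j)
      (hp.hessian_continuous j))).congr
    (Eventually.of_forall fun z => (adjointBracket_eq j z.1 z.2).symm)

theorem aestronglyMeasurable_adjointBracket_slice (hS : S.Standing) (hm : S.IsState a m)
    (hp : S.IsAdjoint a m p) {j : Fin M} (ha : S.IsControl (a j)) {t : ℝ} (ht : t ∈ Ico 0 S.T) :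
    AEStronglyMeasurable fun x => S.adjointBracket a m p j t x := by
  simp_rw [adjointBracket_eq]
  exact (hm.measurable_adjointSource hS ha).of_uncurry_left.aestronglyMeasurable.add
    (hS.aestronglyMeasurable_generator_slice ha (hp.contDiff j t ht) (Ico_subset_Icc_self ht))

theorem exists_abs_adjointBracket_le (hS : S.Standing) (hm : S.IsState a m)
    (hp : S.IsAdjoint a m p) (ha : ∀ j, S.IsControl (a j)) {τ : ℝ} (hτ : τ ∈ Ico 0 S.T) :
    ∃ C, 0 ≤ C ∧ ∀ j, ∀ t ∈ Icc 0 τ, ∀ x,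
      |S.adjointBracket a m p j t x| ≤ C * (1 + ‖x‖) ^ 2 := by
  obtain ⟨B, hB⟩ := hp.exists_hasQuadraticJet hτ
  obtain ⟨K, hK0, hK⟩ := hS.exists_abs_generator_le
  obtain ⟨D, hD0, hD⟩ := hm.exists_abs_adjointSource_le hS ha
  refine ⟨D + K * |B|, by positivity, fun j t ht x => ?_⟩
  have htT : t ∈ Icc 0 S.T := ⟨ht.1, ht.2.trans hτ.2.le⟩
  rw [adjointBracket_eq, add_mul]
  refine (abs_add_le _ _).trans (add_le_add (hD j t htT x) ?_)
  refine (hK t htT x _ ((ha j).mem_hull t x) B _ (hB j t ht)).trans ?_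
  gcongr
  exact le_abs_self B

theorem IsAdjoint.exists_isWeakPairing (hS : S.Standing) (ha : ∀ j, S.IsControl (a j))
    (hm : S.IsState a m) (hp : S.IsAdjoint a m p) (hm' : S.IsState a' m') {j : Fin M}
    (ha' : S.IsControl (a' j)) {τ : ℝ} (hτ : τ ∈ Ico 0 S.T) :
    ∃ C, IsWeakPairing volume τ (p j) (fun t x => -S.adjointBracket a m p j t x) (m' j)
      (fun x => C * (1 + ‖x‖) ^ 2)
      fun t u => ∫ x, S.generator u (a' j u x) (p j t) x * m' j u x := by
  obtain ⟨B, hB⟩ := hp.exists_hasQuadraticJet hτ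
  obtain ⟨C, _, hC⟩ := exists_abs_adjointBracket_le hS hm hp ha hτ
  have hmem {t : ℝ} (ht : t ∈ Icc 0 τ) : t ∈ Icc 0 S.T := ⟨ht.1, ht.2.trans hτ.2.le⟩
  have hmem' {t : ℝ} (ht : t ∈ Icc 0 τ) : t ∈ Ico 0 S.T := ⟨ht.1, ht.2.trans_lt hτ.2⟩
  have hτ' : τ ∈ Icc 0 τ := ⟨hτ.1, le_rfl⟩
  refine ⟨C, ?_, fun t ht x => (abs_neg _).trans_le (hC j t ht x), fun t ht => ?_,
    fun s hs t ht => ?_, ?_, fun t ht r hr s hs => ?_, fun t ht => ?_, ?_, fun ε hε => ?_⟩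
  · exact aestronglyMeasurable_restrict_Ioc
      (aestronglyMeasurable_adjointBracket hS hm hp (ha j)).neg hτ.2.le
  · simpa only [mul_assoc] using (hm'.density j t (hmem ht)).integrable_weight.const_mul C
  · exact (hm'.density j t (hmem ht)).integrable_mul
      (hB j s hs).contDiff.continuous.aestronglyMeasurable (hB j s hs).abs_le
  · filter_upwards [hp.equation j] with x hx s hs t ht
    rw [hx s (hmem' hs) t (hmem' ht), intervalIntegral.integral_neg]
  · exact hm'.integral_mul_sub_integral_mul hS ha' (hB j t ht) (hmem hr) (hmem hs)
  · exact hm'.intervalIntegrable_generator hS ha' (hmem hτ')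
      (hS.aestronglyMeasurable_generator_of_contDiff ha' (hB j t ht).contDiff) fun _ _ => hB j t ht
  · exact hm'.intervalIntegrable_generator hS ha' (hmem hτ')
      (hS.aestronglyMeasurable_generator ha' (hp.gradient_continuous j) (hp.hessian_continuous j))
      (hB j)
  · exact exists_modulus_integral_generator hS hp hm' ha' hτ hε

theorem IsState.exists_integral_abs_weight_le (hm : S.IsState a m) (j : Fin M) (C : ℝ) :
    ∃ D, ∀ t ∈ Icc 0 S.T, ∫ x, |C * (1 + ‖x‖) ^ 2 * m j t x| ≤ D := by
  obtain ⟨D, hD⟩ := hm.exists_integral_weight_le j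
  refine ⟨|C| * D, fun t ht => ?_⟩
  have habs (x : Pt d) :
      |C * (1 + ‖x‖) ^ 2 * m j t x| = |C| * ((1 + ‖x‖) ^ 2 * m j t x) := by
    rw [mul_assoc, abs_mul, abs_of_nonneg (mul_nonneg (by positivity)
      ((hm.density j t ht).nonneg x))]
  simp only [habs, integral_const_mul]
  exact mul_le_mul_of_nonneg_left (hD t ht) (abs_nonneg C)

theorem state_adjoint_duality_of_lt (hS : S.Standing) (ha : ∀ j, S.IsControl (a j))
    (hm : S.IsState a m) (hp : S.IsAdjoint a m p) (hm' : S.IsState a' m') {j : Fin M}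
    (ha' : S.IsControl (a' j)) {τ : ℝ} (hτ : τ ∈ Ico 0 S.T) :
    (∫ x, p j τ x * m' j τ x) - ∫ x, p j 0 x * m' j 0 x =
      ∫ t in 0..τ, ∫ x, S.adjointGap a m p (a' j) j t x * m' j t x := by
  obtain ⟨C, hpair⟩ := hp.exists_isWeakPairing hS ha hm hm' ha' hτ
  obtain ⟨B, hB⟩ := hp.exists_hasQuadraticJet hτ
  have hB0 : 0 ≤ B := by simpa using (abs_nonneg _).trans ((hB j 0 ⟨le_rfl, hτ.1⟩).abs_le 0)
  have hmem {t : ℝ} (ht : t ∈ Icc 0 τ) : t ∈ Icc 0 S.T := ⟨ht.1, ht.2.trans hτ.2.le⟩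
  obtain ⟨K, hK0, hK⟩ := hS.exists_abs_generator_le
  obtain ⟨D, hD⟩ := hm'.exists_abs_integral_mul_le j (C := K * B) (by positivity)
  obtain ⟨E, hE⟩ := hm'.exists_integral_abs_weight_le j C
  rw [← hpair.integral_eq_sub hτ.1 (fun t ht u hu => hD u (hmem hu) _ fun x =>
    hK u (hmem hu) x _ (ha'.mem_hull u x) _ _ (hB j t ht)) fun t ht => hE t (hmem ht)]
  refine intervalIntegral.integral_congr fun t ht => ?_
  rw [uIcc_of_le hτ.1] at ht
  obtain ⟨L, -, hL⟩ := exists_abs_adjointBracket_le hS hm hp ha hτ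
  have hbracket := (hm'.density j t (hmem ht)).integrable_mul
    (aestronglyMeasurable_adjointBracket_slice hS hm hp (ha j) ⟨ht.1, ht.2.trans_lt hτ.2⟩).neg
    fun x => (abs_neg _).trans_le (hL j t ht x)
  have hgenerator := hm'.integrable_generator_mul hS ha' (hB j t ht) (hmem ht)
  simp only [adjointGap_eq, add_mul]
  exact (integral_add hbracket hgenerator).symm

theorem IsAdjoint.exists_abs_le (hT : 0 < S.T) (hp : S.IsAdjoint a m p) : ∃ C,
    ∀ j, ∀ t ∈ Icc 0 S.T, ∀ x, |p j t x| ≤ C * (1 + ‖x‖) ^ 2 := by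
  obtain ⟨C, -, hC⟩ := hp.exists_growth
  refine ⟨C, fun j t ht x => ?_⟩
  rw [← closure_Ico hT.ne] at ht
  refine le_on_closure (fun t ht => (hC j t ht x).2) (f := fun t => |p j t x|) ?_
    continuousOn_const ht
  rw [closure_Ico hT.ne]
  exact ((hp.continuous j).comp (f := fun t => (t, x)) (by fun_prop)
    fun t ht => ⟨ht, mem_univ x⟩).abs

theorem integrable_adjointGap_mul (hS : S.Standing) (ha : ∀ j, S.IsControl (a j))
    (hm : S.IsState a m) (hp : S.IsAdjoint a m p) (hm' : S.IsState a' m') {j : Fin M}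
    (ha' : S.IsControl (a' j)) :
    Integrable (fun z : ℝ × Pt d => S.adjointGap a m p (a' j) j z.1 z.2 * m' j z.1 z.2)
      (S.timeVol.prod volume) := by
  obtain ⟨C, -, hC⟩ := exists_adjointGap_bound hS ha hm hp
  exact hm'.integrable_mul j (aestronglyMeasurable_adjointGap hS ha hm hp ha' j)
    fun t ht => hC _ ha' j t (Ioo_subset_Ico_self ht)

theorem state_adjoint_duality (hS : S.Standing) (ha : ∀ j, S.IsControl (a j))
    (hm : S.IsState a m) (hp : S.IsAdjoint a m p) (hm' : S.IsState a' m') {j : Fin M}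
    (ha' : S.IsControl (a' j)) :
    (∫ x, S.Ψ j x * m' j S.T x) - ∫ x, p j 0 x * m' j 0 x =
      ∫ z, S.adjointGap a m p (a' j) j z.1 z.2 * m' j z.1 z.2 ∂(S.timeVol.prod volume) := by
  have hint := integrable_adjointGap_mul hS ha hm hp hm' ha'
  obtain ⟨C, hC⟩ := hp.exists_abs_le hS.T_pos
  have hinterval : IntervalIntegrable
      (fun t => ∫ x, S.adjointGap a m p (a' j) j t x * m' j t x) volume 0 S.T :=
    (intervalIntegrable_iff_integrableOn_Ioo_of_le hS.T_pos.le).2 hint.integral_prod_left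
  have hprimitive := intervalIntegral.continuousOn_primitive_interval' hinterval left_mem_uIcc
  rw [uIcc_of_le hS.T_pos.le] at hprimitive
  have heq : EqOn (fun τ => (∫ x, p j τ x * m' j τ x) - ∫ x, p j 0 x * m' j 0 x)
      (fun τ => ∫ t in 0..τ, ∫ x, S.adjointGap a m p (a' j) j t x * m' j t x) (Icc 0 S.T) :=
    EqOn.of_subset_closure (fun τ hτ => state_adjoint_duality_of_lt hS ha hm hp hm' ha' hτ)
      ((hm'.continuousOn_integral_mul j (hp.continuous j) (hC j)).sub continuousOn_const)
      hprimitive Ico_subset_Icc_self (closure_Ico hS.T_pos.ne).ge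
  rw [integral_prod _ hint, ← intervalIntegral_eq_timeVol hS.T_pos.le]
  simpa only [hp.terminal] using heq ⟨hS.T_pos.le, le_rfl⟩

end Duality

end CrowdModel

/-! ### One-sided derivatives of the total Hamiltonian -/

theorem le_sub_of_convexOn_of_tendsto {E : Type*} [AddCommGroup E] [Module ℝ E] {s : Set E}
    {f : E → ℝ} (hf : ConvexOn ℝ s f) {x y : E} (hx : x ∈ s) (hy : y ∈ s) {L : ℝ}
    (hL : Filter.Tendsto (fun ε : ℝ => ε⁻¹ * (f ((1 - ε) • x + ε • y) - f x)) (nhdsWithin 0 (Ioi 0))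
      (nhds L)) : L ≤ f y - f x := by
  refine le_of_tendsto hL ?_
  filter_upwards [Ioo_mem_nhdsGT (one_pos : (0 : ℝ) < 1)] with ε hε
  have hconvex := hf.2 hx hy (sub_nonneg.2 hε.2.le) hε.1.le (sub_add_cancel 1 ε)
  rw [smul_eq_mul, smul_eq_mul] at hconvex
  rw [inv_mul_le_iff₀ hε.1]
  linarith

namespace CrowdModel

open Function Filter Topology

section Hamiltonian

variable {d M : ℕ} {S : CrowdModel d M} {a : Fin M → ℝ → Pt d → Pt d}
  {m p : Fin M → ℝ → Pt d → ℝ}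

/-- The factor `½|α|² + b(t,x,α)·∇p_j` of the density `m_j` in the Hamiltonian. -/
noncomputable def localCost (S : CrowdModel d M) (p : Fin M → ℝ → Pt d → ℝ) (j : Fin M) (t : ℝ)
    (x α : Pt d) : ℝ :=
  (1 / 2) * ‖α‖ ^ 2 + inner ℝ (S.b t x α) (gradient (p j t) x)

/-- The crowd aversion density `G_{φ_r}[u]ᵀ Λ v`, polarized to a bilinear form in `(u, v)`. -/
noncomputable def interaction (S : CrowdModel d M) (u v : Fin M → Pt d → ℝ) (x : Pt d) : ℝ :=
  ∑ j, ∑ k, S.Λ j k * (S.G u x j * v k x)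

theorem dotProduct_eq_interaction (u v : Fin M → Pt d → ℝ) (x : Pt d) :
    S.G u x ⬝ᵥ (S.Λ *ᵥ fun j => v j x) = S.interaction u v x := by
  simp only [interaction, dotProduct, Matrix.mulVec, Finset.mul_sum]
  exact Finset.sum_congr rfl fun j _ => Finset.sum_congr rfl fun k _ => by ring

theorem hamiltonian_eq (t : ℝ) (x : Pt d) (α : Fin M → Pt d) (u : Fin M → Pt d → ℝ) :
    S.hamiltonian t x α u p =
      (∑ j, S.localCost p j t x (α j) * u j x) + S.interaction u u x := by
  rw [hamiltonian, runningCost, dotProduct_eq_interaction, add_right_comm, ← Finset.sum_add_distrib]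
  congr 1
  refine Finset.sum_congr rfl fun j _ => ?_
  rw [localCost, real_inner_smul_left]
  ring

theorem convex_controlProfiles : Convex ℝ S.controlProfiles :=
  fun _ hα _ hβ s r hs hr hsr j =>
    ⟨((hα j).1.const_smul s).add ((hβ j).1.const_smul r),
      fun x => convex_convexHull ℝ S.A ((hα j).2 x) ((hβ j).2 x) hs hr hsr⟩

theorem convex_densityProfiles : Convex ℝ (densityProfiles : Set (Fin M → Pt d → ℝ)) := by
  intro u hu v hv s r hs hr hsr j
  have hmoment : Integrable fun x => s * (‖x‖ ^ 2 * u j x) + r * (‖x‖ ^ 2 * v j x) :=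
    ((hu j).secondMoment.const_mul s).add ((hv j).secondMoment.const_mul r)
  have hmass : ∫ x, (s * u j x + r * v j x) = 1 := by
    rw [integral_add ((hu j).integrable.const_mul s) ((hv j).integrable.const_mul r),
      integral_const_mul, integral_const_mul, (hu j).integral_eq_one, (hv j).integral_eq_one,
      mul_one, mul_one, hsr]
  exact
    { measurable := ((hu j).measurable.const_mul s).add ((hv j).measurable.const_mul r)
      nonneg := fun x =>
        add_nonneg (mul_nonneg hs ((hu j).nonneg x)) (mul_nonneg hr ((hv j).nonneg x))
      integrable := ((hu j).integrable.const_mul s).add ((hv j).integrable.const_mul r)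
      integral_eq_one := hmass
      secondMoment := hmoment.congr <| Eventually.of_forall fun x => by
        simp only [Pi.add_apply, Pi.smul_apply, smul_eq_mul]
        ring }

theorem exists_abs_localCost_le (hS : S.Standing) (hp : S.IsAdjoint a m p) : ∃ C,
    ∀ j, ∀ t ∈ Ico 0 S.T, ∀ x, ∀ α ∈ convexHull ℝ S.A,
      |S.localCost p j t x α| ≤ C * (1 + ‖x‖) ^ 2 := by
  obtain ⟨K, _, hK⟩ := hS.exists_growth
  obtain ⟨C, -, hC⟩ := exists_abs_inner_drift_le hS hp
  refine ⟨(1 / 2) * K ^ 2 + C, fun j t ht x α hα => ?_⟩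
  have hweight : (1 : ℝ) ≤ (1 + ‖x‖) ^ 2 := one_le_pow₀ (by linarith [norm_nonneg x])
  have hαK := (hK t (Ico_subset_Icc_self ht) x α hα).1
  have hkinetic : |(1 / 2) * ‖α‖ ^ 2| ≤ (1 / 2) * K ^ 2 * (1 + ‖x‖) ^ 2 := by
    rw [abs_of_nonneg (by positivity)]
    calc (1 / 2) * ‖α‖ ^ 2 ≤ (1 / 2) * K ^ 2 := by gcongr
      _ ≤ _ := le_mul_of_one_le_right (by positivity) hweight
  rw [add_mul]
  exact (abs_add_le _ _).trans (add_le_add hkinetic (hC t ht x α hα j))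

theorem exists_abs_localCost_sub_le (hS : S.Standing) (hp : S.IsAdjoint a m p) : ∃ C, 0 ≤ C ∧
    ∀ j, ∀ t ∈ Ico 0 S.T, ∀ x, ∀ α ∈ convexHull ℝ S.A, ∀ β ∈ convexHull ℝ S.A,
      |S.localCost p j t x β - S.localCost p j t x α| ≤ C * (1 + ‖x‖) ^ 2 * ‖β - α‖ := by
  obtain ⟨K, hK0, hK⟩ := hS.exists_growth
  obtain ⟨C, hC0, hC⟩ := hp.exists_growth
  refine ⟨K + K * C, by positivity, fun j t ht x α hα β hβ => ?_⟩
  obtain ⟨hαK, -, -, hlip⟩ := hK t (Ico_subset_Icc_self ht) x α hα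
  have hβK := (hK t (Ico_subset_Icc_self ht) x β hβ).1
  have hweight : (1 : ℝ) ≤ 1 + ‖x‖ := by linarith [norm_nonneg x]
  have hsplit : S.localCost p j t x β - S.localCost p j t x α =
      (1 / 2) * ((‖β‖ + ‖α‖) * (‖β‖ - ‖α‖)) +
        inner ℝ (S.b t x β - S.b t x α) (gradient (p j t) x) := by
    rw [localCost, localCost, inner_sub_left]
    ring
  have hkinetic : |(1 / 2) * ((‖β‖ + ‖α‖) * (‖β‖ - ‖α‖))| ≤ K * (1 + ‖x‖) ^ 2 * ‖β - α‖ :=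
    calc |(1 / 2) * ((‖β‖ + ‖α‖) * (‖β‖ - ‖α‖))|
        = 1 / 2 * ((‖β‖ + ‖α‖) * |‖β‖ - ‖α‖|) := by
          rw [abs_mul, abs_mul, abs_of_nonneg (by positivity : 0 ≤ ‖β‖ + ‖α‖),
            abs_of_pos (one_half_pos (α := ℝ))]
      _ ≤ 1 / 2 * ((K + K) * ‖β - α‖) := by gcongr; exact abs_norm_sub_norm_le β α
      _ = K * 1 * ‖β - α‖ := by ring
      _ ≤ _ := by gcongr; exact one_le_pow₀ hweight
  have hdrift : |inner ℝ (S.b t x β - S.b t x α) (gradient (p j t) x)| ≤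
      K * C * (1 + ‖x‖) ^ 2 * ‖β - α‖ :=
    calc |inner ℝ (S.b t x β - S.b t x α) (gradient (p j t) x)|
        ≤ ‖S.b t x β - S.b t x α‖ * ‖gradient (p j t) x‖ := abs_real_inner_le_norm _ _
      _ ≤ (K * ‖β - α‖) * (C * (1 + ‖x‖)) :=
          mul_le_mul (hlip β hβ) (hC j t ht x).1 (norm_nonneg _) (by positivity)
      _ = K * C * (1 + ‖x‖) * ‖β - α‖ := by ring
      _ ≤ _ := by gcongr; exact le_self_pow₀ hweight two_ne_zero
  rw [hsplit, add_mul K, add_mul (K * _)]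
  exact (abs_add_le _ _).trans (add_le_add hkinetic hdrift)

theorem exists_abs_localCost_quotient_le (hS : S.Standing) (hp : S.IsAdjoint a m p) : ∃ C, 0 ≤ C ∧
    ∀ j, ∀ t ∈ Ico 0 S.T, ∀ x, ∀ α ∈ convexHull ℝ S.A, ∀ β ∈ convexHull ℝ S.A,
      ∀ ε ∈ Ioo (0 : ℝ) 1,
        |ε⁻¹ * (S.localCost p j t x ((1 - ε) • α + ε • β) - S.localCost p j t x α)| ≤
          C * (1 + ‖x‖) ^ 2 := by
  obtain ⟨K, hK0, hK⟩ := hS.exists_growth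
  obtain ⟨C, hC0, hC⟩ := exists_abs_localCost_sub_le hS hp
  refine ⟨C * (K + K), by positivity, fun j t ht x α hα β hβ ε hε => ?_⟩
  have hαK := (hK t (Ico_subset_Icc_self ht) x α hα).1
  have hβK := (hK t (Ico_subset_Icc_self ht) x β hβ).1
  have hmem : (1 - ε) • α + ε • β ∈ convexHull ℝ S.A :=
    convex_convexHull ℝ S.A hα hβ (sub_nonneg.2 hε.2.le) hε.1.le (sub_add_cancel 1 ε)
  have hstep : ‖(1 - ε) • α + ε • β - α‖ ≤ ε * (K + K) := by
    rw [show (1 - ε) • α + ε • β - α = ε • (β - α) by module, norm_smul,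
      Real.norm_of_nonneg hε.1.le]
    exact mul_le_mul_of_nonneg_left ((norm_sub_le β α).trans (add_le_add hβK hαK)) hε.1.le
  rw [abs_mul, abs_inv, abs_of_pos hε.1, inv_mul_le_iff₀ hε.1]
  calc _ ≤ C * (1 + ‖x‖) ^ 2 * ‖(1 - ε) • α + ε • β - α‖ := hC j t ht x α hα _ hmem
    _ ≤ C * (1 + ‖x‖) ^ 2 * (ε * (K + K)) := by gcongr
    _ = _ := by ring

theorem Standing.differentiableAt_localCost (hS : S.Standing) (j : Fin M) {t : ℝ}
    (ht : t ∈ Icc 0 S.T) (x : Pt d) {α : Pt d} (hα : α ∈ S.A) :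
    DifferentiableAt ℝ (S.localCost p j t x) α :=
  ((differentiableAt_id.norm_sq ℝ).const_mul (1 / 2)).add
    ((hS.b_differentiable t ht x α hα).inner ℝ (differentiableAt_const _))

theorem measurable_localCost (hS : S.Standing) (hp : S.IsAdjoint a m p) (j : Fin M) {t : ℝ}
    (ht : t ∈ Ico 0 S.T) {α : Pt d → Pt d} (hα : Measurable α)
    (hmem : ∀ x, α x ∈ convexHull ℝ S.A) : Measurable fun x => S.localCost p j t x (α x) :=
  ((hα.norm.pow_const 2).const_mul _).add
    ((hS.measurable_drift (Ico_subset_Icc_self ht) hα hmem).inner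
      (continuous_gradient_of_contDiff (hp.contDiff j t ht)).measurable)

theorem integrable_localCost_mul (hS : S.Standing) (hp : S.IsAdjoint a m p) {j : Fin M} {t : ℝ}
    (ht : t ∈ Ico 0 S.T) {α : Fin M → Pt d → Pt d} (hα : α ∈ S.controlProfiles)
    {u : Pt d → ℝ} (hu : IsDensity2 u) :
    Integrable fun x => S.localCost p j t x (α j x) * u x := by
  obtain ⟨C, hC⟩ := exists_abs_localCost_le hS hp
  exact hu.integrable_mul
    (measurable_localCost hS hp j ht (hα j).1 (hα j).2).aestronglyMeasurable
    fun x => hC j t ht x _ ((hα j).2 x)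

theorem Standing.integrable_G_mul (hS : S.Standing) {u : Fin M → Pt d → ℝ} {j : Fin M}
    (hu : IsDensity2 (u j)) {v : Pt d → ℝ} (hv : Integrable v) :
    Integrable fun x => S.G u x j * v x := by
  obtain ⟨C, -, hC⟩ := hS.exists_G_bound
  exact hv.bdd_mul (c := C) (hS.measurable_G_profile j hu.measurable).aestronglyMeasurable
    (Eventually.of_forall fun x => hC u j hu x)

theorem Standing.integrable_interaction (hS : S.Standing) {u v : Fin M → Pt d → ℝ}
    (hu : u ∈ densityProfiles) (hv : v ∈ densityProfiles) : Integrable (S.interaction u v) :=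
  integrable_finsetSum _ fun j _ => integrable_finsetSum _ fun k _ =>
    (hS.integrable_G_mul (hu j) (hv k).integrable).const_mul _

theorem integrable_hamiltonian (hS : S.Standing) (hp : S.IsAdjoint a m p) {t : ℝ}
    (ht : t ∈ Ico 0 S.T) {α : Fin M → Pt d → Pt d} (hα : α ∈ S.controlProfiles)
    {u : Fin M → Pt d → ℝ} (hu : u ∈ densityProfiles) :
    Integrable fun x => S.hamiltonian t x (fun j => α j x) u p := by
  simp only [hamiltonian_eq]
  exact (integrable_finsetSum _ fun j _ => integrable_localCost_mul hS hp ht hα (hu j)).add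
    (hS.integrable_interaction hu hu)

theorem totalHamiltonian_eq (hS : S.Standing) (hp : S.IsAdjoint a m p) {t : ℝ}
    (ht : t ∈ Ico 0 S.T) {α : Fin M → Pt d → Pt d} (hα : α ∈ S.controlProfiles)
    {u : Fin M → Pt d → ℝ} (hu : u ∈ densityProfiles) :
    S.totalHamiltonian p t α u =
      (∑ j, ∫ x, S.localCost p j t x (α j x) * u j x) + ∫ x, S.interaction u u x := by
  have hlocal (j : Fin M) := integrable_localCost_mul hS hp (j := j) ht hα (hu j)
  simp_rw [totalHamiltonian, hamiltonian_eq]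
  rw [integral_add (integrable_finsetSum _ fun j _ => hlocal j) (hS.integrable_interaction hu hu),
    integral_finsetSum _ fun j _ => hlocal j]

/-- The derivative of the total Hamiltonian in the controls, at the profiles `α` with densities
`u`, in the direction `w`. -/
noncomputable def controlDerivative (S : CrowdModel d M) (p : Fin M → ℝ → Pt d → ℝ) (t : ℝ)
    (α : Fin M → Pt d → Pt d) (u : Fin M → Pt d → ℝ) (w : Fin M → Pt d → Pt d) : ℝ :=
  ∑ j, ∫ x, fderiv ℝ (S.localCost p j t x) (α j x) (w j x) * u j x

/-- The derivative of the total Hamiltonian in the densities, at the profiles `α` with densities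
`u`, applied to `v`. -/
noncomputable def densityDerivative (S : CrowdModel d M) (p : Fin M → ℝ → Pt d → ℝ) (t : ℝ)
    (α : Fin M → Pt d → Pt d) (u v : Fin M → Pt d → ℝ) : ℝ :=
  (∑ j, ∫ x, S.localCost p j t x (α j x) * v j x) +
    ((∫ x, S.interaction u v x) + ∫ x, S.interaction v u x)

theorem Standing.interaction_segment (hS : S.Standing) {u v : Fin M → Pt d → ℝ}
    (hu : u ∈ densityProfiles) (hv : v ∈ densityProfiles) (ε : ℝ) (x : Pt d) :
    S.interaction ((1 - ε) • u + ε • v) ((1 - ε) • u + ε • v) x =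
      (1 - ε) ^ 2 * S.interaction u u x +
        (1 - ε) * ε * (S.interaction u v x + S.interaction v u x) +
        ε ^ 2 * S.interaction v v x := by
  have hG (j : Fin M) :
      S.G ((1 - ε) • u + ε • v) x j = (1 - ε) * S.G u x j + ε * S.G v x j := by
    simp only [G, Pi.add_apply, Pi.smul_apply, smul_eq_mul]
    rw [← integral_const_mul, ← integral_const_mul, ← integral_add
      ((hS.integrable_kernel_mul (hu j).integrable x).const_mul _)
      ((hS.integrable_kernel_mul (hv j).integrable x).const_mul _)]
    congr 1
    funext y
    ring
  simp only [interaction, hG, Pi.add_apply, Pi.smul_apply, smul_eq_mul, Finset.mul_sum,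
    ← Finset.sum_add_distrib]
  exact Finset.sum_congr rfl fun j _ => Finset.sum_congr rfl fun k _ => by ring

theorem Standing.integral_interaction_segment (hS : S.Standing) {u v : Fin M → Pt d → ℝ}
    (hu : u ∈ densityProfiles) (hv : v ∈ densityProfiles) (ε : ℝ) :
    ∫ x, S.interaction ((1 - ε) • u + ε • v) ((1 - ε) • u + ε • v) x =
      (1 - ε) ^ 2 * (∫ x, S.interaction u u x) +
        (1 - ε) * ε * ((∫ x, S.interaction u v x) + ∫ x, S.interaction v u x) +
        ε ^ 2 * ∫ x, S.interaction v v x := by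
  have huu := hS.integrable_interaction hu hu
  have hvv := hS.integrable_interaction hv hv
  have hcross : Integrable fun x => S.interaction u v x + S.interaction v u x :=
    (hS.integrable_interaction hu hv).add (hS.integrable_interaction hv hu)
  have hlower : Integrable fun x => (1 - ε) ^ 2 * S.interaction u u x +
      (1 - ε) * ε * (S.interaction u v x + S.interaction v u x) :=
    (huu.const_mul _).add (hcross.const_mul _)
  simp_rw [hS.interaction_segment hu hv]
  rw [integral_add hlower (hvv.const_mul _),
    integral_add (huu.const_mul _) (hcross.const_mul _), integral_const_mul, integral_const_mul,
    integral_const_mul,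
    integral_add (hS.integrable_interaction hu hv) (hS.integrable_interaction hv hu)]

theorem totalHamiltonian_density_segment (hS : S.Standing) (hp : S.IsAdjoint a m p) {t : ℝ}
    (ht : t ∈ Ico 0 S.T) {α : Fin M → Pt d → Pt d} (hα : α ∈ S.controlProfiles)
    {u v : Fin M → Pt d → ℝ} (hu : u ∈ densityProfiles) (hv : v ∈ densityProfiles) {ε : ℝ}
    (hε : ε ∈ Ioo (0 : ℝ) 1) :
    S.totalHamiltonian p t α ((1 - ε) • u + ε • v) - S.totalHamiltonian p t α u =
      ε * (S.densityDerivative p t α u v - S.densityDerivative p t α u u) +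
        ε ^ 2 * ((∫ x, S.interaction u u x) -
          ((∫ x, S.interaction u v x) + ∫ x, S.interaction v u x) +
          ∫ x, S.interaction v v x) := by
  have hlocal (j : Fin M) : ∫ x, S.localCost p j t x (α j x) * ((1 - ε) • u + ε • v) j x =
      (1 - ε) * (∫ x, S.localCost p j t x (α j x) * u j x) +
        ε * ∫ x, S.localCost p j t x (α j x) * v j x := by
    rw [← integral_const_mul, ← integral_const_mul,
      ← integral_add ((integrable_localCost_mul hS hp ht hα (hu j)).const_mul _)
        ((integrable_localCost_mul hS hp ht hα (hv j)).const_mul _)]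
    congr 1
    funext x
    simp only [Pi.add_apply, Pi.smul_apply, smul_eq_mul]
    ring
  have hmem := convex_densityProfiles hu hv (sub_nonneg.2 hε.2.le) hε.1.le (sub_add_cancel 1 ε)
  rw [totalHamiltonian_eq hS hp ht hα hmem, totalHamiltonian_eq hS hp ht hα hu,
    hS.integral_interaction_segment hu hv]
  simp_rw [hlocal, Finset.sum_add_distrib, ← Finset.mul_sum, densityDerivative]
  ring

theorem tendsto_integral_localCost_quotient (hS : S.Standing) (hp : S.IsAdjoint a m p)
    (j : Fin M) {t : ℝ} (ht : t ∈ Ico 0 S.T) {α β : Fin M → Pt d → Pt d}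
    (hα : α ∈ S.controlProfiles) (hA : ∀ j x, α j x ∈ S.A) (hβ : β ∈ S.controlProfiles)
    {u v : Fin M → Pt d → ℝ} (hu : u ∈ densityProfiles) (hv : v ∈ densityProfiles) :
    Tendsto (fun ε : ℝ => ∫ x, ε⁻¹ * (S.localCost p j t x ((1 - ε) • α j x + ε • β j x) -
        S.localCost p j t x (α j x)) * ((1 - ε) • u + ε • v) j x) (𝓝[>] 0)
      (𝓝 (∫ x, fderiv ℝ (S.localCost p j t x) (α j x) (β j x - α j x) * u j x)) := by
  obtain ⟨C, hC0, hC⟩ := exists_abs_localCost_quotient_le hS hp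
  have hunit : ∀ᶠ ε : ℝ in 𝓝[>] 0, ε ∈ Ioo (0 : ℝ) 1 := Ioo_mem_nhdsGT one_pos
  refine tendsto_integral_filter_of_dominated_convergence
    (fun x => C * ((1 + ‖x‖) ^ 2 * u j x + (1 + ‖x‖) ^ 2 * v j x)) ?measurable ?bound
    (((hu j).integrable_weight.add (hv j).integrable_weight).const_mul C) ?limit
  case measurable =>
    filter_upwards [hunit] with ε hε
    have hmem := convex_controlProfiles hα hβ (sub_nonneg.2 hε.2.le) hε.1.le (sub_add_cancel 1 ε) j
    exact (((measurable_localCost hS hp j ht hmem.1 hmem.2).sub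
      (measurable_localCost hS hp j ht (hα j).1 (hα j).2)).const_mul _).mul
      (((hu j).measurable.const_mul _).add ((hv j).measurable.const_mul _))
      |>.aestronglyMeasurable
  case bound =>
    filter_upwards [hunit] with ε hε
    refine Eventually.of_forall fun x => ?_
    have hu0 := (hu j).nonneg x
    have hv0 := (hv j).nonneg x
    have hε0 : 0 ≤ 1 - ε := sub_nonneg.2 hε.2.le
    have hcombo0 : 0 ≤ (1 - ε) * u j x + ε * v j x :=
      add_nonneg (mul_nonneg hε0 hu0) (mul_nonneg hε.1.le hv0)
    have hcombo : (1 - ε) * u j x + ε * v j x ≤ u j x + v j x :=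
      add_le_add (mul_le_of_le_one_left hu0 (by linarith [hε.1]))
        (mul_le_of_le_one_left hv0 hε.2.le)
    rw [← mul_add, ← mul_assoc, norm_mul]
    exact mul_le_mul (hC j t ht x _ ((hα j).2 x) _ ((hβ j).2 x) ε hε)
      ((Real.norm_of_nonneg hcombo0).trans_le hcombo) (norm_nonneg _) (by positivity)
  case limit =>
    refine Eventually.of_forall fun x => ?_
    have hquotient := ((hS.differentiableAt_localCost (p := p) j (Ico_subset_Icc_self ht) x
      (hA j x)).hasFDerivAt.hasLineDerivAt (β j x - α j x)).tendsto_slope_zero_right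
    have hcombo : Tendsto (fun ε : ℝ => (1 - ε) * u j x + ε * v j x) (𝓝[>] 0) (𝓝 (u j x)) := by
      have hcont : Continuous fun ε : ℝ => (1 - ε) * u j x + ε * v j x := by fun_prop
      simpa using (hcont.tendsto 0).mono_left nhdsWithin_le_nhds
    refine (hquotient.mul hcombo).congr fun ε => ?_
    rw [smul_eq_mul, show (1 - ε) • α j x + ε • β j x = α j x + ε • (β j x - α j x) by module]
    rfl

theorem tendsto_totalHamiltonian_control_increment (hS : S.Standing) (hp : S.IsAdjoint a m p)
    {t : ℝ} (ht : t ∈ Ico 0 S.T) {α β : Fin M → Pt d → Pt d} (hα : α ∈ S.controlProfiles)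
    (hA : ∀ j x, α j x ∈ S.A) (hβ : β ∈ S.controlProfiles) {u v : Fin M → Pt d → ℝ}
    (hu : u ∈ densityProfiles) (hv : v ∈ densityProfiles) :
    Tendsto (fun ε : ℝ => ε⁻¹ *
        (S.totalHamiltonian p t ((1 - ε) • α + ε • β) ((1 - ε) • u + ε • v) -
          S.totalHamiltonian p t α ((1 - ε) • u + ε • v))) (𝓝[>] 0)
      (𝓝 (S.controlDerivative p t α u (β - α))) := by
  refine (tendsto_finsetSum Finset.univ fun j _ =>
    tendsto_integral_localCost_quotient hS hp j ht hα hA hβ hu hv).congr' ?_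
  filter_upwards [Ioo_mem_nhdsGT (one_pos : (0 : ℝ) < 1)] with ε hε
  have hε0 : 0 ≤ 1 - ε := sub_nonneg.2 hε.2.le
  have hαε := convex_controlProfiles hα hβ hε0 hε.1.le (sub_add_cancel 1 ε)
  have huε := convex_densityProfiles hu hv hε0 hε.1.le (sub_add_cancel 1 ε)
  rw [totalHamiltonian_eq hS hp ht hαε huε, totalHamiltonian_eq hS hp ht hα huε,
    add_sub_add_right_eq_sub, ← Finset.sum_sub_distrib, Finset.mul_sum]
  refine Finset.sum_congr rfl fun j _ => ?_
  rw [← integral_sub (integrable_localCost_mul hS hp ht hαε (huε j))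
    (integrable_localCost_mul hS hp ht hα (huε j)), ← integral_const_mul]
  congr 1
  funext x
  rw [← sub_mul, mul_assoc]
  rfl

theorem tendsto_totalHamiltonian_segment (hS : S.Standing) (hp : S.IsAdjoint a m p)
    {t : ℝ} (ht : t ∈ Ico 0 S.T) {α β : Fin M → Pt d → Pt d} (hα : α ∈ S.controlProfiles)
    (hA : ∀ j x, α j x ∈ S.A) (hβ : β ∈ S.controlProfiles) {u v : Fin M → Pt d → ℝ}
    (hu : u ∈ densityProfiles) (hv : v ∈ densityProfiles) :
    Tendsto (fun ε : ℝ => ε⁻¹ *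
        (S.totalHamiltonian p t ((1 - ε) • α + ε • β) ((1 - ε) • u + ε • v) -
          S.totalHamiltonian p t α u)) (𝓝[>] 0)
      (𝓝 (S.controlDerivative p t α u (β - α) +
        (S.densityDerivative p t α u v - S.densityDerivative p t α u u))) := by
  set D := S.densityDerivative p t α u v - S.densityDerivative p t α u u
  set Q := (∫ x, S.interaction u u x) -
    ((∫ x, S.interaction u v x) + ∫ x, S.interaction v u x) + ∫ x, S.interaction v v x
  have hdensity : Tendsto (fun ε : ℝ => D + ε * Q) (𝓝[>] 0) (𝓝 D) := by
    have hcont : Continuous fun ε : ℝ => D + ε * Q := by fun_prop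
    simpa using (hcont.tendsto 0).mono_left nhdsWithin_le_nhds
  refine ((tendsto_totalHamiltonian_control_increment hS hp ht hα hA hβ hu hv).add
    hdensity).congr' ?_
  filter_upwards [Ioo_mem_nhdsGT (one_pos : (0 : ℝ) < 1)] with ε hε
  rw [← sub_add_sub_cancel _ (S.totalHamiltonian p t α ((1 - ε) • u + ε • v))
      (S.totalHamiltonian p t α u),
    totalHamiltonian_density_segment hS hp ht hα hu hv hε, mul_add]
  have hε0 : ε ≠ 0 := hε.1.ne'
  field_simp
  rfl

/-- The total Hamiltonian minus its linearization in the densities at the profiles `α₀`, `u₀`. -/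
noncomputable def reducedHamiltonian (S : CrowdModel d M) (p : Fin M → ℝ → Pt d → ℝ) (t : ℝ)
    (α₀ : Fin M → Pt d → Pt d) (u₀ : Fin M → Pt d → ℝ) (α : Fin M → Pt d → Pt d)
    (u : Fin M → Pt d → ℝ) : ℝ :=
  S.totalHamiltonian p t α u - S.densityDerivative p t α₀ u₀ u

theorem HamiltonianConvex.reducedHamiltonian_le (hconv : S.HamiltonianConvex p) (hS : S.Standing)
    (hp : S.IsAdjoint a m p) {t : ℝ} (ht : t ∈ Ico 0 S.T) {α β : Fin M → Pt d → Pt d}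
    (hα : α ∈ S.controlProfiles) (hA : ∀ j x, α j x ∈ S.A) (hβ : β ∈ S.controlProfiles)
    {u v : Fin M → Pt d → ℝ} (hu : u ∈ densityProfiles) (hv : v ∈ densityProfiles)
    (hstationary : 0 ≤ S.controlDerivative p t α u (β - α)) :
    S.reducedHamiltonian p t α u α u ≤ S.reducedHamiltonian p t α u β v := by
  have hle := le_sub_of_convexOn_of_tendsto (hconv t ht) (x := (α, u)) (y := (β, v)) ⟨hα, hu⟩
    ⟨hβ, hv⟩ (tendsto_totalHamiltonian_segment hS hp ht hα hA hβ hu hv)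
  rw [reducedHamiltonian, reducedHamiltonian]
  linarith

theorem HamiltonianSepConvex.reducedHamiltonian_le (hconv : S.HamiltonianSepConvex p)
    (hS : S.Standing) (hp : S.IsAdjoint a m p) {t : ℝ} (ht : t ∈ Ico 0 S.T)
    {α β : Fin M → Pt d → Pt d} (hα : α ∈ S.controlProfiles) (hA : ∀ j x, α j x ∈ S.A)
    (hβ : β ∈ S.controlProfiles) {u v : Fin M → Pt d → ℝ} (hu : u ∈ densityProfiles)
    (hv : v ∈ densityProfiles) (hstationary : 0 ≤ S.controlDerivative p t α v (β - α)) :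
    S.reducedHamiltonian p t α u α u ≤ S.reducedHamiltonian p t α u β v := by
  have hcontrol : 0 ≤ S.totalHamiltonian p t β v - S.totalHamiltonian p t α v := by
    refine hstationary.trans (le_sub_of_convexOn_of_tendsto ((hconv t ht).1 v hv) hα hβ ?_)
    simpa only [Convex.combo_self (sub_add_cancel (1 : ℝ) _), sub_self, add_zero]
      using tendsto_totalHamiltonian_segment hS hp ht hα hA hβ hv hv
  have hdensity : S.densityDerivative p t α u v - S.densityDerivative p t α u u ≤
      S.totalHamiltonian p t α v - S.totalHamiltonian p t α u := by
    refine le_sub_of_convexOn_of_tendsto ((hconv t ht).2 α hα) hu hv ?_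
    have hzero : S.controlDerivative p t α u (α - α) = 0 := by simp [controlDerivative]
    simpa only [Convex.combo_self (sub_add_cancel (1 : ℝ) _), hzero, zero_add]
      using tendsto_totalHamiltonian_segment hS hp ht hα hA hα hu hv
  rw [reducedHamiltonian, reducedHamiltonian]
  linarith

end Hamiltonian

/-! ### The first variation and the cost -/

section FirstVariation

variable {d M : ℕ} {S : CrowdModel d M} {a a' : Fin M → ℝ → Pt d → Pt d}
  {m m' p : Fin M → ℝ → Pt d → ℝ}

theorem dHamiltonian_eq (hS : S.Standing) (j : Fin M) {t : ℝ} (ht : t ∈ Icc 0 S.T) (x : Pt d)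
    {α : Fin M → Pt d} (hα : α j ∈ S.A) (u : Fin M → Pt d → ℝ) (w : Pt d) :
    S.dHamiltonian j t x α u p w = fderiv ℝ (S.localCost p j t x) (α j) w * u j x := by
  have hlocal : (fun v => S.hamiltonian t x (update α j v) u p) = fun v =>
      S.localCost p j t x v * u j x + ((∑ i ∈ Finset.univ.erase j,
        S.localCost p i t x (α i) * u i x) + S.interaction u u x) := by
    funext v
    rw [hamiltonian_eq, ← Finset.add_sum_erase _ _ (Finset.mem_univ j), update_self, add_assoc]
    congr 2
    exact Finset.sum_congr rfl fun i hi => by rw [update_of_ne (Finset.ne_of_mem_erase hi)]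
  rw [dHamiltonian, hlocal, fderiv_add_const,
    fderiv_mul_const (hS.differentiableAt_localCost j ht x hα), smul_apply,
    smul_eq_mul, mul_comm]

theorem FirstVariationVanishes.integrable_and_integral_eq_zero (hT : 0 ≤ S.T)
    (hopt : S.FirstVariationVanishes a m p) (j : Fin M) {w : ℝ → Pt d → Pt d}
    (hw : S.IsControl w) :
    Integrable (fun z : ℝ × Pt d => S.dHamiltonian j z.1 z.2 (fun k => a k z.1 z.2)
        (fun k => m k z.1) p (w z.1 z.2)) (S.timeVol.prod volume) ∧
      ∫ z : ℝ × Pt d, S.dHamiltonian j z.1 z.2 (fun k => a k z.1 z.2)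
        (fun k => m k z.1) p (w z.1 z.2) ∂(S.timeVol.prod volume) = 0 := by
  obtain ⟨hint, hzero⟩ := hopt j w hw
  have hint' := hint.mono_set (prod_mono_left (t := univ) Ioo_subset_Icc_self)
  rw [IntegrableOn, ← timeVol_prod] at hint'
  refine ⟨hint', ?_⟩
  rw [integral_prod_symm _ hint', ← hzero]
  simp_rw [intervalIntegral_eq_timeVol hT]

theorem FirstVariationVanishes.ae_eq_zero (hS : S.Standing) (ha : ∀ j, S.IsControl (a j))
    (hopt : S.FirstVariationVanishes a m p) (j : Fin M) {α : ℝ → Pt d → Pt d}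
    (hα : S.IsControl α) :
    ∀ᵐ z ∂(S.timeVol.prod (volume : Measure (Pt d))),
      fderiv ℝ (S.localCost p j z.1 z.2) (a j z.1 z.2) (α z.1 z.2 - a j z.1 z.2) *
        m j z.1 z.2 = 0 := by
  classical
  set D : (ℝ → Pt d → Pt d) → ℝ × Pt d → ℝ := fun w z => S.dHamiltonian j z.1 z.2
    (fun k => a k z.1 z.2) (fun k => m k z.1) p (w z.1 z.2) with hD
  have hvar {w} (hw : S.IsControl w) : Integrable (D w) (S.timeVol.prod volume) ∧
      ∫ z, D w z ∂(S.timeVol.prod volume) = 0 :=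
    hopt.integrable_and_integral_eq_zero hS.T_pos.le j hw
  have hdiff : D α - D (a j) =ᵐ[S.timeVol.prod volume] 0 := by
    refine ((hvar hα).1.sub (hvar (ha j)).1).ae_eq_zero_of_forall_setIntegral_eq_zero
      fun E hE _ => ?_
    -- Testing with `α` on `E` and `a j` elsewhere localizes the first variation to `E`.
    set w : ℝ → Pt d → Pt d := fun t x => if (t, x) ∈ E then α t x else a j t x with hw
    have hwc : S.IsControl w := by
      refine ⟨Measurable.ite hE hα.1 (ha j).1, fun t x => ?_⟩
      simp only [hw]
      split_ifs
      exacts [hα.2 t x, (ha j).2 t x]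
    have hsplice : E.indicator (D α - D (a j)) = D w - D (a j) := by
      funext z
      by_cases hz : z ∈ E <;> simp [hD, hw, hz]
    rw [← integral_indicator hE, hsplice, integral_sub' (hvar hwc).1 (hvar (ha j)).1,
      (hvar hwc).2, (hvar (ha j)).2, sub_zero]
  have hmem : ∀ᵐ z ∂(S.timeVol.prod (volume : Measure (Pt d))), z.1 ∈ Icc 0 S.T :=
    ae_timeVol_prod fun t ht _ => Ioo_subset_Icc_self ht
  filter_upwards [hdiff, hmem] with z hz ht
  simp only [hD, Pi.sub_apply] at hz
  rwa [dHamiltonian_eq hS j ht z.2 ((ha j).2 _ _),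
    dHamiltonian_eq hS j ht z.2 ((ha j).2 _ _), ← sub_mul, ← map_sub] at hz

theorem IsControl.mem_controlProfiles (ha : ∀ j, S.IsControl (a j)) (t : ℝ) :
    (fun j => a j t) ∈ S.controlProfiles := fun j =>
  ⟨(ha j).1.comp measurable_prodMk_left, fun x => (ha j).mem_hull t x⟩

theorem IsState.mem_densityProfiles (hm : S.IsState a m) {t : ℝ} (ht : t ∈ Icc 0 S.T) :
    (fun j => m j t) ∈ densityProfiles := fun j => hm.density j t ht

theorem adjointInteraction_mul_eq_sum (u : Fin M → Pt d → ℝ) (j : Fin M) (x : Pt d) (r : ℝ) :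
    S.adjointInteraction u j x * r = ∑ k, (S.Λ k j + S.Λ j k) * (S.G u x k * r) := by
  rw [adjointInteraction_eq_sum, Finset.sum_mul]
  exact Finset.sum_congr rfl fun k _ => by ring

theorem Standing.integrable_adjointInteraction_mul (hS : S.Standing) {u : Fin M → Pt d → ℝ}
    (hu : u ∈ densityProfiles) {v : Pt d → ℝ} (hv : Integrable v) (j : Fin M) :
    Integrable fun x => S.adjointInteraction u j x * v x := by
  simp only [adjointInteraction_mul_eq_sum]
  exact integrable_finsetSum _ fun k _ => (hS.integrable_G_mul (hu k) hv).const_mul _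

theorem Standing.integral_interaction (hS : S.Standing) {u v : Fin M → Pt d → ℝ}
    (hu : u ∈ densityProfiles) (hv : v ∈ densityProfiles) :
    ∫ x, S.interaction u v x = ∑ j, ∑ k, S.Λ j k * ∫ x, S.G u x j * v k x := by
  have hint (j k) : Integrable fun x => S.Λ j k * (S.G u x j * v k x) :=
    (hS.integrable_G_mul (hu j) (hv k).integrable).const_mul _
  simp only [interaction]
  rw [integral_finsetSum _ fun j _ => integrable_finsetSum _ fun k _ => hint j k]
  simp only [integral_finsetSum _ fun k _ => hint _ k, integral_const_mul]

theorem Standing.integral_adjointInteraction (hS : S.Standing) {u v : Fin M → Pt d → ℝ}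
    (hu : u ∈ densityProfiles) (hv : v ∈ densityProfiles) :
    ∑ j, ∫ x, S.adjointInteraction u j x * v j x =
      (∫ x, S.interaction u v x) + ∫ x, S.interaction v u x := by
  have hswap : ∫ x, S.interaction v u x = ∑ j, ∑ k, S.Λ j k * ∫ x, S.G u x k * v j x := by
    simp only [hS.integral_interaction hv hu,
      hS.integral_G_mul_comm (hv _).integrable (hu _).integrable, mul_comm (v _ _)]
  have hexpand (j) : ∫ x, S.adjointInteraction u j x * v j x =
      ∑ k, (S.Λ k j + S.Λ j k) * ∫ x, S.G u x k * v j x := by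
    simp only [adjointInteraction_mul_eq_sum]
    rw [integral_finsetSum _ fun k _ =>
      (hS.integrable_G_mul (hu k) (hv j).integrable).const_mul _]
    simp only [integral_const_mul]
  simp only [hexpand, add_mul, Finset.sum_add_distrib]
  rw [hS.integral_interaction hu hv, hswap, Finset.sum_comm]

/-- The running cost of the pair `(a', m')`, corrected by the terms which, by duality, replace the
terminal cost when the adjoint state `p` belongs to the pair `(a, m)`. -/
noncomputable def reducedCost (S : CrowdModel d M) (a : Fin M → ℝ → Pt d → Pt d)
    (m p : Fin M → ℝ → Pt d → ℝ) (a' : Fin M → ℝ → Pt d → Pt d) (m' : Fin M → ℝ → Pt d → ℝ)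
    (t : ℝ) (x : Pt d) : ℝ :=
  S.runningCost x (fun j => a' j t x) (fun j => m' j t) +
    ∑ j, S.adjointGap a m p (a' j) j t x * m' j t x

theorem reducedCost_eq (t : ℝ) (x : Pt d) :
    S.reducedCost a m p a' m' t x =
      S.hamiltonian t x (fun j => a' j t x) (fun j => m' j t) p -
        ∑ j, (S.localCost p j t x (a j t x) * m' j t x +
          S.adjointInteraction (fun k => m k t) j x * m' j t x) := by
  rw [reducedCost, hamiltonian, add_sub_assoc, ← Finset.sum_sub_distrib]
  congr 1
  refine Finset.sum_congr rfl fun j _ => ?_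
  rw [adjointGap, adjointSource, localCost, real_inner_smul_left]
  ring

theorem integrable_runningCost (hS : S.Standing) (ha : ∀ j, S.IsControl (a j))
    (hm : S.IsState a m) :
    Integrable (fun z : ℝ × Pt d => S.runningCost z.2 (fun j => a j z.1 z.2) fun j => m j z.1)
      (S.timeVol.prod volume) := by
  obtain ⟨K, -, hK⟩ := hS.exists_growth
  obtain ⟨C, hC0, hC⟩ := hS.exists_G_bound
  have hweight (x : Pt d) : (1 : ℝ) ≤ (1 + ‖x‖) ^ 2 :=
    one_le_pow₀ (by linarith [norm_nonneg x])
  simp only [runningCost, dotProduct_eq_interaction]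
  refine Integrable.add (integrable_finsetSum _ fun j _ => ?control)
    (integrable_finsetSum _ fun j _ => integrable_finsetSum _ fun k _ =>
      Integrable.const_mul ?interaction _)
  case control =>
    refine hm.integrable_mul j (φ := fun t x => (1 / 2) * ‖a j t x‖ ^ 2) (C := (1 / 2) * K ^ 2)
      (((ha j).1.norm.pow_const 2).const_mul _).aestronglyMeasurable fun t ht x => ?_
    have hbound : (1 / 2) * ‖a j t x‖ ^ 2 ≤ (1 / 2) * K ^ 2 := by
      gcongr
      exact (hK t (Ioo_subset_Icc_self ht) x _ ((ha j).mem_hull t x)).1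
    rw [abs_of_nonneg (by positivity)]
    exact hbound.trans (le_mul_of_one_le_right (by positivity) (hweight x))
  case interaction =>
    refine hm.integrable_mul k (φ := fun t x => S.G (fun j => m j t) x j) (C := C)
      (hS.measurable_G j (hm.measurable j)).aestronglyMeasurable fun t ht x => ?_
    exact (hC _ j (hm.density j t (Ioo_subset_Icc_self ht)) x).trans
      (le_mul_of_one_le_right hC0 (hweight x))

theorem integrable_reducedCost (hS : S.Standing) (ha : ∀ j, S.IsControl (a j))
    (hm : S.IsState a m) (hp : S.IsAdjoint a m p) (ha' : ∀ j, S.IsControl (a' j))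
    (hm' : S.IsState a' m') :
    Integrable (uncurry (S.reducedCost a m p a' m')) (S.timeVol.prod volume) :=
  (integrable_runningCost hS ha' hm').add
    (integrable_finsetSum _ fun j _ => integrable_adjointGap_mul hS ha hm hp hm' (ha' j))

theorem IsState.integral_initial (hT : 0 ≤ S.T) (hm : S.IsState a m) (j : Fin M)
    (f : Pt d → ℝ) : ∫ x, f x * m j 0 x = ∫ x, f x ∂(S.μ₀ j) := by
  have hdensity := hm.density j 0 ⟨le_rfl, hT⟩
  rw [hm.initial j, integral_withDensity_eq_integral_toReal_smul
    hdensity.measurable.ennreal_ofReal (Eventually.of_forall fun x => ENNReal.ofReal_lt_top)]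
  simp only [ENNReal.toReal_ofReal (hdensity.nonneg _), smul_eq_mul, mul_comm]

theorem cost_eq (hS : S.Standing) (ha : ∀ j, S.IsControl (a j))
    (hm : S.IsState a m) (hp : S.IsAdjoint a m p) (ha' : ∀ j, S.IsControl (a' j))
    (hm' : S.IsState a' m') :
    S.cost a' m' = (∑ j, ∫ x, p j 0 x ∂(S.μ₀ j)) +
      ∫ t, (∫ x, S.reducedCost a m p a' m' t x) ∂S.timeVol := by
  have hTmem : S.T ∈ Icc 0 S.T := ⟨hS.T_pos.le, le_rfl⟩
  obtain ⟨C, hC⟩ := hp.exists_abs_le hS.T_pos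
  have hrunning := integrable_runningCost hS ha' hm'
  have hgap (j) := integrable_adjointGap_mul hS ha hm hp hm' (ha' j)
  have hterminal (j) : Integrable fun x => S.Ψ j x * m' j S.T x :=
    (hm'.density j S.T hTmem).integrable_mul (hS.continuous_terminalCost j).aestronglyMeasurable
      fun x => hp.terminal j x ▸ hC j S.T hTmem x
  have hduality (j) : ∫ x, S.Ψ j x * m' j S.T x = (∫ x, p j 0 x ∂(S.μ₀ j)) +
      ∫ z, S.adjointGap a m p (a' j) j z.1 z.2 * m' j z.1 z.2 ∂(S.timeVol.prod volume) := by
    rw [← state_adjoint_duality hS ha hm hp hm' (ha' j), hm'.integral_initial hS.T_pos.le,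
      add_sub_cancel]
  calc S.cost a' m'
      = (∫ z : ℝ × Pt d, S.runningCost z.2 (fun j => a' j z.1 z.2) (fun j => m' j z.1)
          ∂(S.timeVol.prod volume)) + ∑ j, ∫ x, S.Ψ j x * m' j S.T x := by
        simp only [cost, intervalIntegral_eq_timeVol hS.T_pos.le]
        rw [integral_add hrunning.integral_prod_right
          (integrable_finsetSum _ fun j _ => hterminal j),
          integral_finsetSum _ fun j _ => hterminal j, integral_prod_symm _ hrunning]
    _ = (∑ j, ∫ x, p j 0 x ∂(S.μ₀ j)) +
          ∫ z, uncurry (S.reducedCost a m p a' m') z ∂(S.timeVol.prod volume) := by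
        simp only [hduality, Finset.sum_add_distrib, uncurry_def, reducedCost]
        rw [integral_add hrunning (integrable_finsetSum _ fun j _ => hgap j),
          integral_finsetSum _ fun j _ => hgap j, add_left_comm]
    _ = _ := by rw [integral_prod _ (integrable_reducedCost hS ha hm hp ha' hm')]; rfl

theorem integral_reducedCost (hS : S.Standing) (ha : ∀ j, S.IsControl (a j))
    (hm : S.IsState a m) (hp : S.IsAdjoint a m p) (ha' : ∀ j, S.IsControl (a' j))
    (hm' : S.IsState a' m') {t : ℝ} (ht : t ∈ Ico 0 S.T) :
    ∫ x, S.reducedCost a m p a' m' t x =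
      S.reducedHamiltonian p t (fun j => a j t) (fun j => m j t) (fun j => a' j t)
        (fun j => m' j t) := by
  have hu := hm.mem_densityProfiles (Ico_subset_Icc_self ht)
  have hv := hm'.mem_densityProfiles (Ico_subset_Icc_self ht)
  have hlocal (j) : Integrable fun x => S.localCost p j t x (a j t x) * m' j t x :=
    integrable_localCost_mul hS hp ht (IsControl.mem_controlProfiles ha t) (hv j)
  have hinteraction (j) :
      Integrable fun x => S.adjointInteraction (fun k => m k t) j x * m' j t x :=
    hS.integrable_adjointInteraction_mul hu (hv j).integrable j
  have hdensity (j) : Integrable fun x => S.localCost p j t x (a j t x) * m' j t x +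
      S.adjointInteraction (fun k => m k t) j x * m' j t x := (hlocal j).add (hinteraction j)
  simp only [reducedCost_eq]
  rw [integral_sub (integrable_hamiltonian hS hp ht (IsControl.mem_controlProfiles ha' t) hv)
    (integrable_finsetSum _ fun j _ => hdensity j), integral_finsetSum _ fun j _ => hdensity j]
  simp only [integral_add (hlocal _) (hinteraction _), Finset.sum_add_distrib,
    hS.integral_adjointInteraction hu hv]
  rfl

theorem controlDerivative_eq_zero {t : ℝ} {α w : Fin M → Pt d → Pt d} {u : Fin M → Pt d → ℝ}
    (h : ∀ j, ∀ᵐ x, fderiv ℝ (S.localCost p j t x) (α j x) (w j x) * u j x = 0) :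
    S.controlDerivative p t α u w = 0 :=
  Finset.sum_eq_zero fun j _ => integral_eq_zero_of_ae (h j)

theorem ae_reducedHamiltonian_le (hS : S.Standing) (ha : ∀ j, S.IsControl (a j))
    (hm : S.IsState a m) (hp : S.IsAdjoint a m p)
    (hconv : S.HamiltonianConvex p ∨
      (S.HamiltonianSepConvex p ∧
        ∀ j, ∀ᵐ z : ℝ × Pt d ∂(volume.restrict (Icc 0 S.T ×ˢ univ)), 0 < m j z.1 z.2))
    (hopt : S.FirstVariationVanishes a m p) (ha' : ∀ j, S.IsControl (a' j))
    (hm' : S.IsState a' m') :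
    ∀ᵐ t ∂S.timeVol,
      S.reducedHamiltonian p t (fun j => a j t) (fun j => m j t) (fun j => a j t)
          (fun j => m j t) ≤
        S.reducedHamiltonian p t (fun j => a j t) (fun j => m j t) (fun j => a' j t)
          (fun j => m' j t) := by
  have hzero (j) := hopt.ae_eq_zero hS ha j (ha' j)
  have hmem : ∀ᵐ t ∂S.timeVol, t ∈ Ioo 0 S.T := ae_timeVol fun _ => id
  rcases hconv with hconv | ⟨hconv, hpos⟩
  · filter_upwards [hmem, ae_all_iff.2 fun j => Measure.ae_ae_of_ae_prod (hzero j)]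
      with t ht hstationary
    exact hconv.reducedHamiltonian_le hS hp (Ioo_subset_Ico_self ht)
      (IsControl.mem_controlProfiles ha t) (fun j => (ha j).2 t)
      (IsControl.mem_controlProfiles ha' t) (hm.mem_densityProfiles (Ioo_subset_Icc_self ht))
      (hm'.mem_densityProfiles (Ioo_subset_Icc_self ht))
      (controlDerivative_eq_zero hstationary).ge
  · have hderiv (j) : ∀ᵐ z ∂(S.timeVol.prod (volume : Measure (Pt d))),
        fderiv ℝ (S.localCost p j z.1 z.2) (a j z.1 z.2) (a' j z.1 z.2 - a j z.1 z.2) = 0 := by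
      have hpos' : ∀ᵐ z ∂(S.timeVol.prod (volume : Measure (Pt d))), 0 < m j z.1 z.2 := by
        rw [timeVol_prod]
        exact ae_restrict_of_ae_restrict_of_subset (prod_mono_left Ioo_subset_Icc_self) (hpos j)
      filter_upwards [hzero j, hpos'] with z hz hmz
      exact (mul_eq_zero.1 hz).resolve_right hmz.ne'
    filter_upwards [hmem, ae_all_iff.2 fun j => Measure.ae_ae_of_ae_prod (hderiv j)]
      with t ht hstationary
    exact hconv.reducedHamiltonian_le hS hp (Ioo_subset_Ico_self ht)
      (IsControl.mem_controlProfiles ha t) (fun j => (ha j).2 t)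
      (IsControl.mem_controlProfiles ha' t) (hm.mem_densityProfiles (Ioo_subset_Icc_self ht))
      (hm'.mem_densityProfiles (Ioo_subset_Icc_self ht))
      (controlDerivative_eq_zero fun j => (hstationary j).mono fun x hx =>
        mul_eq_zero_of_left hx _).ge

end FirstVariation

end CrowdModel

theorem theorem4p2 {d M : ℕ} (S : CrowdModel d M) (hS : S.Standing)
    (a : Fin M → ℝ → Pt d → Pt d) (m p : Fin M → ℝ → Pt d → ℝ)
    (ha : ∀ j, S.IsControl (a j)) (hm : S.IsState a m) (hp : S.IsAdjoint a m p)
    (hconv : S.HamiltonianConvex p ∨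
      (S.HamiltonianSepConvex p ∧
        ∀ j, ∀ᵐ z : ℝ × Pt d ∂(volume.restrict (Icc 0 S.T ×ˢ univ)), 0 < m j z.1 z.2))
    (hopt : S.FirstVariationVanishes a m p) :
    S.SolvesOC a m := by
  refine ⟨ha, hm, fun a' m' ha' hm' => ?_⟩
  rw [CrowdModel.cost_eq hS ha hm hp ha hm, CrowdModel.cost_eq hS ha hm hp ha' hm']
  refine add_le_add_right (integral_mono_ae
    (CrowdModel.integrable_reducedCost hS ha hm hp ha hm).integral_prod_left
    (CrowdModel.integrable_reducedCost hS ha hm hp ha' hm').integral_prod_left ?_) _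
  have hmem : ∀ᵐ t ∂S.timeVol, t ∈ Ico 0 S.T :=
    CrowdModel.ae_timeVol fun _ ht => Ioo_subset_Ico_self ht
  filter_upwards [hmem, CrowdModel.ae_reducedHamiltonian_le hS ha hm hp hconv hopt ha' hm']
    with t ht hle
  simp only [Function.uncurry_apply_pair]
  rwa [CrowdModel.integral_reducedCost hS ha hm hp ha hm ht,
    CrowdModel.integral_reducedCost hS ha hm hp ha' hm' ht]
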